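/- Let $\mathbb{H}=\{z\in\mathbb{C}:\operatorname{Im}z>0\}$ with the pseudo-hyperbolic distance $d(z,w)=\left|\frac{w-z}{w-\bar z}\right|$. Let $\phi$ be an analytic self-map of $\mathbb{H}$ such that $\phi(z)\to\infty$ and $\phi(z)/z\to1$ as $z\to\infty$ non-tangentially, i.e. inside each sector $\{|\operatorname{Arg}z-\pi/2|<\theta\}$, $0<\theta<\pi/2$. Write $\phi_n$ for the $n$-th iterate of $\phi$. Let $\{w_n=x_n+iy_n\}_{n\ge0}\subset\mathbb{H}$ be a backward-iteration sequence with bounded steps of type 1 tending to $\infty$ whose argument tends to $0$; that is, $\{w_n\}$ is not constant, $\phi(w_{n+1})=w_n$ for all $n$, $\sup_n d(w_n,w_{n+1})<1$, $w_n\to\infty$, $y_n\to\ell_\infty$ for some $\ell_\infty>0$, and $\operatorname{Arg}w_n\to0$. For $R>0$ and $0<\epsilon<1$ put $\mathbb{S}(R,\epsilon)=\{x+iy:\ x\ge R,\ \epsilon\le y\le 1/\epsilon\}$. A simply connected region (connected open set) $\Omega\subset\mathbb{H}$ is said to have an inner-lateral tangent at $+\infty$ if for every $0<\epsilon<1$ there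 is $R>0$ with $\mathbb{S}(R,\epsilon)\subset\Omega$. Let $\tau_n(z)=x_n+y_nz$. Then the limit $a=\lim_n d(w_n,w_{n+1})<1$ exists, and the normalized iterates $\phi_n\circ\tau_n$ converge, uniformly on compact subsets of $\mathbb{H}$, to an analytic self-map $\psi$ of $\mathbb{H}$ (the conjugation associated with $\{w_n\}$) satisfying $\psi(z-b_0)=\phi(\psi(z))$ for all $z\in\mathbb{H}$, where $b_0=\frac{2a}{\sqrt{1-a^2}}=\lim_n\frac{x_{n+1}-x_n}{y_n}$. Moreover, there is a convex region $\Omega\subset\mathbb{H}$ with an inner-lateral tangent at $+\infty$ such that $\psi$ is one-to-one on $\Omega$ and $\psi(\Omega)$ also has an inner-lateral tangent at $+\infty$. -/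

import Mathlib

open Filter Topology UpperHalfPlane

/-- The pseudo-hyperbolic distance of the upper half-plane, for points of the upper half-plane. -/
noncomputable def pseudoHypDist (z w : ℂ) : ℝ :=
  ‖(w - z) / (w - (starRingEnd ℂ) z)‖

/-- `f z` tends to `l` as `z` tends to infinity non-tangentially in the upper half-plane,
i.e. inside every sector `{|Arg z - π / 2| < θ}` with `0 < θ < π / 2`. -/
def TendstoNontangentialInfty (f : ℂ → ℂ) (l : Filter ℂ) : Prop :=
  ∀ θ : ℝ, 0 < θ → θ < Real.pi / 2 →
    Tendsto f (Bornology.cobounded ℂ ⊓ 𝓟 {z : ℂ | |z.arg - Real.pi / 2| < θ}) l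

/-- An analytic self-map of the upper half-plane, of parabolic type with Denjoy-Wolff point at
infinity: `φ(z) → ∞` and `φ(z) / z → 1` as `z → ∞` non-tangentially. Only the values of `φ`
on the upper half-plane matter. -/
structure IsParabolicSelfMap (φ : ℂ → ℂ) : Prop where
  analytic : DifferentiableOn ℂ φ upperHalfPlaneSet
  mapsTo : Set.MapsTo φ upperHalfPlaneSet upperHalfPlaneSet
  tendsto_infty : TendstoNontangentialInfty φ (Bornology.cobounded ℂ)
  multiplier_one : TendstoNontangentialInfty (fun z => φ z / z) (𝓝 1)

/-- Backward-iteration sequence with bounded steps (BISBS) for a self-map `φ` of the upper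
half-plane; the trivial (constant) sequences are excluded. -/
structure IsBISBS (φ : ℂ → ℂ) (w : ℕ → ℂ) : Prop where
  mem : ∀ n, w n ∈ upperHalfPlaneSet
  backward : ∀ n, φ (w (n + 1)) = w n
  bounded_steps : ∃ a : ℝ, a < 1 ∧ ∀ n, pseudoHypDist (w n) (w (n + 1)) ≤ a
  nontrivial : ∃ n, w n ≠ w 0

/-- Type 1 (non-zero height): the imaginary parts converge to a positive limit. (For a BISBS of a
parabolic map they are automatically non-increasing.) -/
def IsTypeOne (w : ℕ → ℂ) : Prop :=
  ∃ l : ℝ, 0 < l ∧ Tendsto (fun n => (w n).im) atTop (𝓝 l)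

/-- The automorphism `τ_p(z) = Re p + (Im p) z` of the upper half-plane, sending `i` to `p`. -/
noncomputable def halfPlaneAut (p z : ℂ) : ℂ := (p.re : ℂ) + (p.im : ℂ) * z

/-- `ψ` is the conjugation attached to the BISBS `w` of `φ`, with translation length `b₀`:
the normalized iterates `φ_n ∘ τ_n`, where `τ_n(z) = x_n + y_n z` and `w_n = x_n + i y_n`, converge
to `ψ` uniformly on compact subsets of the upper half-plane, `ψ` is an analytic self-map of the
upper half-plane, `ψ(z - b₀) = φ(ψ(z))`, and
`b₀ = 2a / √(1 - a²) = lim (x_{n+1} - x_n) / y_n` with `a < 1` the limit of the steps. -/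
structure IsConjugation (φ : ℂ → ℂ) (w : ℕ → ℂ) (ψ : ℂ → ℂ) (b₀ : ℝ) : Prop where
  tendsto_iterates : ∀ K : Set ℂ, K ⊆ upperHalfPlaneSet → IsCompact K →
    TendstoUniformlyOn (fun (n : ℕ) (z : ℂ) => φ^[n] (halfPlaneAut (w n) z)) ψ atTop K
  analytic : DifferentiableOn ℂ ψ upperHalfPlaneSet
  mapsTo : Set.MapsTo ψ upperHalfPlaneSet upperHalfPlaneSet
  conj : ∀ z ∈ upperHalfPlaneSet, ψ (z - (b₀ : ℂ)) = φ (ψ z)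
  step : ∃ a : ℝ, a < 1 ∧
    Tendsto (fun n => pseudoHypDist (w n) (w (n + 1))) atTop (𝓝 a) ∧
    b₀ = 2 * a / Real.sqrt (1 - a ^ 2)
  tendsto_ratio :
    Tendsto (fun n => ((w (n + 1)).re - (w n).re) / (w n).im) atTop (𝓝 b₀)

/-- The horizontal half-strip `{x + iy : x ≥ R, ε ≤ y ≤ 1 / ε}`. -/
def halfStrip (R ε : ℝ) : Set ℂ :=
  {z : ℂ | R ≤ z.re ∧ ε ≤ z.im ∧ z.im ≤ 1 / ε}

/-- `Ω` is a simply connected region (open, connected) in the upper half-plane with an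
inner-lateral tangent at `+∞`: for every `0 < ε < 1` it contains some half-strip. -/
structure HasInnerLateralTangent (Ω : Set ℂ) : Prop where
  isOpen : IsOpen Ω
  simplyConnected : IsSimplyConnected Ω
  subset : Ω ⊆ upperHalfPlaneSet
  strips : ∀ ε : ℝ, 0 < ε → ε < 1 → ∃ R : ℝ, 0 < R ∧ halfStrip R ε ⊆ Ω

/-! The maps `G = τ_m⁻¹ ∘ φ_k ∘ τ_{m+k}` fix `i`, and they send `τ_{m+k}⁻¹(w_{m+k+1})` to
`τ_m⁻¹(w_{m+1})`. Both points are close to `i + b₀` for large `m`. A self-map of the half-plane that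
fixes one point and almost fixes another is close to the identity on compact sets
(`exists_forall_norm_map_sub_lt`, a quantitative Schwarz lemma), so `G` tends to the identity
uniformly in `k`.

Since `φ_{m+k} ∘ τ_{m+k} = (φ_m ∘ τ_m) ∘ G`, Schwarz-Pick makes the normalized iterates uniformly
Cauchy. This gives `ψ`, and the functional equation follows because `τ_{n+1}⁻¹ ∘ τ_n` tends to
translation by `-b₀`.

Letting `k → ∞` with `m` fixed gives `ψ(z + m b₀) ≈ τ_m(z)`: far to the right `ψ` is nearly a real
translate of dilation by the limit height `l` (`tendstoLocallyUniformlyOn_normalized`). Hence `ψ'/l`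
is near `1` far out in each half-strip, which yields injectivity on a convex region, and a
quantitative open mapping theorem puts half-strips inside the image. -/

/-! ### Cayley transforms and the Schwarz-Pick lemma -/

/-- The Cayley transform sending `p` to `0`. -/
noncomputable def cayley (p z : ℂ) : ℂ := (z - p) / (z - (starRingEnd ℂ) p)

/-- The inverse of the Cayley transform sending `p` to `0`. -/
noncomputable def cayleyInv (p ζ : ℂ) : ℂ := (p - (starRingEnd ℂ) p * ζ) / (1 - ζ)

theorem norm_cayley (p z : ℂ) : ‖cayley p z‖ = pseudoHypDist p z := rfl

theorem mem_uhp {z : ℂ} : z ∈ upperHalfPlaneSet ↔ 0 < z.im := Iff.rfl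

theorem sub_conj_ne_zero {p z : ℂ} (hp : 0 < p.im) (hz : 0 < z.im) :
    z - (starRingEnd ℂ) p ≠ 0 := by
  intro h
  have := congrArg Complex.im h
  simp at this
  linarith

theorem pseudoHypDist_nonneg (p z : ℂ) : 0 ≤ pseudoHypDist p z := norm_nonneg _

theorem normSq_sub_conj (p z : ℂ) :
    ‖z - (starRingEnd ℂ) p‖ ^ 2 = ‖z - p‖ ^ 2 + 4 * p.im * z.im := by
  rw [← Complex.normSq_eq_norm_sq, ← Complex.normSq_eq_norm_sq]
  simp [Complex.normSq_apply]
  ring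

theorem pseudoHypDist_mul {p z : ℂ} (hp : 0 < p.im) (hz : 0 < z.im) :
    pseudoHypDist p z * ‖z - (starRingEnd ℂ) p‖ = ‖z - p‖ := by
  rw [pseudoHypDist, norm_div, div_mul_cancel₀]
  exact norm_ne_zero_iff.2 (sub_conj_ne_zero hp hz)

theorem pseudoHypDist_lt_one {p z : ℂ} (hp : 0 < p.im) (hz : 0 < z.im) :
    pseudoHypDist p z < 1 := by
  have h0 : 0 < ‖z - (starRingEnd ℂ) p‖ := norm_pos_iff.2 (sub_conj_ne_zero hp hz)
  rw [pseudoHypDist, norm_div, div_lt_one h0]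
  have := normSq_sub_conj p z
  have h4 : 0 < p.im * z.im := mul_pos hp hz
  nlinarith [norm_nonneg (z - p)]

theorem pseudoHypDist_comm {p z : ℂ} : pseudoHypDist p z = pseudoHypDist z p := by
  have h : ‖z - (starRingEnd ℂ) p‖ = ‖p - (starRingEnd ℂ) z‖ := by
    rw [← Complex.norm_conj, norm_sub_rev]
    simp
  rw [pseudoHypDist, pseudoHypDist, norm_div, norm_div, h, norm_sub_rev]

theorem eq_of_pseudoHypDist_eq_zero {p z : ℂ} (hp : 0 < p.im) (hz : 0 < z.im)
    (h : pseudoHypDist p z = 0) : z = p := by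
  have := pseudoHypDist_mul hp hz
  rw [h, zero_mul] at this
  exact sub_eq_zero.1 (norm_eq_zero.1 this.symm)

theorem cayleyInv_cayley {p z : ℂ} (hp : 0 < p.im) (hz : 0 < z.im) :
    cayleyInv p (cayley p z) = z := by
  have h := sub_conj_ne_zero hp hz
  have h2 := sub_conj_ne_zero hp hp
  have h3 : 1 - cayley p z = (p - (starRingEnd ℂ) p) / (z - (starRingEnd ℂ) p) := by
    rw [cayley]; field_simp; ring
  rw [cayleyInv, h3, cayley]
  field_simp
  ring

theorem cayleyInv_mem {p ζ : ℂ} (hp : 0 < p.im) (hζ : ‖ζ‖ < 1) : 0 < (cayleyInv p ζ).im := by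
  have h1 : (1 : ℂ) - ζ ≠ 0 := by
    intro h
    rw [← sub_eq_zero.1 h] at hζ
    simp at hζ
  have h2 : 0 < Complex.normSq (1 - ζ) := Complex.normSq_pos.2 h1
  have h3 : ζ.re ^ 2 + ζ.im ^ 2 < 1 := by
    have : ‖ζ‖ ^ 2 < 1 := by nlinarith [norm_nonneg ζ]
    rw [← Complex.normSq_eq_norm_sq, Complex.normSq_apply] at this
    nlinarith
  have h4 : (cayleyInv p ζ).im = p.im * (1 - ζ.re ^ 2 - ζ.im ^ 2) / Complex.normSq (1 - ζ) := by
    rw [cayleyInv, Complex.div_im]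
    simp
    ring
  rw [h4]
  exact div_pos (mul_pos hp (by linarith)) h2

theorem differentiableOn_cayley {p : ℂ} (hp : 0 < p.im) :
    DifferentiableOn ℂ (cayley p) upperHalfPlaneSet := by
  intro z hz
  have := sub_conj_ne_zero hp hz
  unfold cayley
  fun_prop (disch := assumption)

theorem differentiableOn_cayleyInv (p : ℂ) :
    DifferentiableOn ℂ (cayleyInv p) (Metric.ball 0 1) := by
  intro ζ hζ
  have h1 : (1 : ℂ) - ζ ≠ 0 := by
    intro h
    rw [← sub_eq_zero.1 h] at hζ
    simp at hζ
  unfold cayleyInv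
  fun_prop (disch := assumption)

theorem mapsTo_cayleyInv {p : ℂ} (hp : 0 < p.im) :
    Set.MapsTo (cayleyInv p) (Metric.ball 0 1) upperHalfPlaneSet := fun ζ hζ =>
  cayleyInv_mem hp (by simpa using hζ)

/-- The Schwarz lemma on the upper half-plane. -/
theorem norm_le_pseudoHypDist {F : ℂ → ℂ} {p w : ℂ} (hF : DifferentiableOn ℂ F upperHalfPlaneSet)
    (hF1 : ∀ z ∈ upperHalfPlaneSet, ‖F z‖ ≤ 1) (hp : 0 < p.im) (hFp : F p = 0) (hw : 0 < w.im) :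
    ‖F w‖ ≤ pseudoHypDist p w := by
  have hd : DifferentiableOn ℂ (F ∘ cayleyInv p) (Metric.ball 0 1) :=
    hF.comp (differentiableOn_cayleyInv p) (mapsTo_cayleyInv hp)
  have h0 : (F ∘ cayleyInv p) 0 = 0 := by simp [cayleyInv, hFp]
  have := Complex.norm_le_norm_of_mapsTo_ball (z := cayley p w) hd
    (fun ζ hζ => by simpa using hF1 _ (mapsTo_cayleyInv hp hζ)) h0
    (by rw [norm_cayley]; exact pseudoHypDist_lt_one hp hw)
  rwa [Function.comp_apply, cayleyInv_cayley hp hw, norm_cayley] at this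

/-- The Schwarz-Pick lemma on the upper half-plane. -/
theorem pseudoHypDist_map_le {f : ℂ → ℂ} {p w : ℂ} (hf : DifferentiableOn ℂ f upperHalfPlaneSet)
    (hm : Set.MapsTo f upperHalfPlaneSet upperHalfPlaneSet) (hp : 0 < p.im) (hw : 0 < w.im) :
    pseudoHypDist (f p) (f w) ≤ pseudoHypDist p w := by
  refine norm_le_pseudoHypDist (F := cayley (f p) ∘ f)
    ((differentiableOn_cayley (hm hp)).comp hf hm) (fun z hz => ?_) hp (by simp [cayley]) hw
  exact (pseudoHypDist_lt_one (hm hp) (hm hz)).le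

/-! ### Rigidity of self-maps with a fixed point -/

/-- Schwarz is applied after a disc automorphism moves `h p` to `0`; the strict bound keeps its
denominator from vanishing. The point is that `h` is almost constant when `‖h p‖` is almost `1`. -/
theorem norm_sub_le_of_norm_lt_one {h : ℂ → ℂ} {p w : ℂ}
    (hh : DifferentiableOn ℂ h upperHalfPlaneSet)
    (h1 : ∀ z ∈ upperHalfPlaneSet, ‖h z‖ < 1) (hp : 0 < p.im) (hw : 0 < w.im) :
    ‖h w - h p‖ * (1 - pseudoHypDist p w) ≤ pseudoHypDist p w * (1 - ‖h p‖ ^ 2) := by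
  set c := h p with hc
  have hc1 : ‖c‖ < 1 := h1 p hp
  have hne : ∀ z ∈ upperHalfPlaneSet, 1 - (starRingEnd ℂ) c * h z ≠ 0 := by
    intro z hz h0
    have h2 : ‖(starRingEnd ℂ) c * h z‖ < 1 := by
      rw [norm_mul, Complex.norm_conj]
      nlinarith [norm_nonneg c, norm_nonneg (h z), h1 z hz]
    rw [← sub_eq_zero.1 h0] at h2
    simp at h2
  have key := norm_le_pseudoHypDist (F := fun z => (h z - c) / (1 - (starRingEnd ℂ) c * h z))
    (p := p) (w := w) ((hh.sub_const c).div ((hh.const_mul _).const_sub 1) hne)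
    (fun z hz => by
      rw [norm_div, div_le_one (norm_pos_iff.2 (hne z hz))]
      apply (sq_le_sq₀ (norm_nonneg _) (norm_nonneg _)).1
      rw [← Complex.normSq_eq_norm_sq, ← Complex.normSq_eq_norm_sq]
      have a1 : Complex.normSq c < 1 := by
        rw [Complex.normSq_eq_norm_sq]; nlinarith [norm_nonneg c]
      have a2 : Complex.normSq (h z) < 1 := by
        rw [Complex.normSq_eq_norm_sq]; nlinarith [norm_nonneg (h z), h1 z hz]
      have : Complex.normSq (1 - (starRingEnd ℂ) c * h z) - Complex.normSq (h z - c)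
          = (1 - Complex.normSq c) * (1 - Complex.normSq (h z)) := by
        simp [Complex.normSq_apply]; ring
      nlinarith) hp (by simp [hc]) hw
  set ρ := pseudoHypDist p w
  have hρ : 0 ≤ ρ := pseudoHypDist_nonneg _ _
  rw [norm_div, div_le_iff₀ (norm_pos_iff.2 (hne w hw))] at key
  have e : 1 - (starRingEnd ℂ) c * h w
      = ((1 - ‖c‖ ^ 2 : ℝ) : ℂ) - (starRingEnd ℂ) c * (h w - c) := by
    rw [← Complex.normSq_eq_norm_sq]
    push_cast
    rw [Complex.normSq_eq_conj_mul_self]; ring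
  have e2 : ‖1 - (starRingEnd ℂ) c * h w‖ ≤ (1 - ‖c‖ ^ 2) + ‖h w - c‖ := by
    rw [e]
    refine (norm_sub_le _ _).trans (add_le_add ?_ ?_)
    · rw [Complex.norm_real, Real.norm_of_nonneg]
      nlinarith [norm_nonneg c]
    · rw [norm_mul, Complex.norm_conj]
      nlinarith [norm_nonneg c, norm_nonneg (h w - c)]
  nlinarith [mul_le_mul_of_nonneg_left e2 hρ]

/-- A quantitative rigidity estimate for holomorphic maps of the half-plane into the closed disc. -/
theorem norm_sub_le_of_norm_le_one {h : ℂ → ℂ} {p w : ℂ}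
    (hh : DifferentiableOn ℂ h upperHalfPlaneSet)
    (h1 : ∀ z ∈ upperHalfPlaneSet, ‖h z‖ ≤ 1) (hp : 0 < p.im) (hw : 0 < w.im) :
    ‖h w - h p‖ * (1 - pseudoHypDist p w) ≤ pseudoHypDist p w * (1 - ‖h p‖ ^ 2) := by
  -- Scaling by `t < 1` gives the strict bound; then `t → 1`.
  have key : ∀ t ∈ Set.Ioo (0 : ℝ) 1, t * ‖h w - h p‖ * (1 - pseudoHypDist p w)
      ≤ pseudoHypDist p w * (1 - (t * ‖h p‖) ^ 2) := by
    intro t ht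
    have := norm_sub_le_of_norm_lt_one (h := fun z => (t : ℂ) * h z) (p := p) (w := w)
      (hh.const_mul _) (fun z hz => by
        rw [norm_mul, Complex.norm_real, Real.norm_of_nonneg ht.1.le]
        nlinarith [h1 z hz, norm_nonneg (h z), ht.1, ht.2]) hp hw
    rwa [← mul_sub, norm_mul, norm_mul, Complex.norm_real, Real.norm_of_nonneg ht.1.le] at this
  have hc : (1 : ℝ) ∈ closure (Set.Ioo (0 : ℝ) 1) := by
    rw [closure_Ioo (by norm_num)]; simp
  have := le_on_closure key (by fun_prop) (by fun_prop) hc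
  simpa using this

theorem cayley_I_sub {u v : ℂ} (hu : 0 < u.im) (hv : 0 < v.im) :
    cayley Complex.I u - cayley Complex.I v
      = 2 * Complex.I * (u - v) / ((u + Complex.I) * (v + Complex.I)) := by
  have h1 := sub_conj_ne_zero (p := Complex.I) (by simp) hu
  have h2 := sub_conj_ne_zero (p := Complex.I) (by simp) hv
  simp only [Complex.conj_I, sub_neg_eq_add] at h1 h2
  simp only [cayley, Complex.conj_I, sub_neg_eq_add]
  field_simp
  ring

theorem one_le_norm_add_I {u : ℂ} (hu : 0 < u.im) : 1 ≤ ‖u + Complex.I‖ := by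
  have := Complex.abs_im_le_norm (u + Complex.I)
  simp at this
  rw [abs_of_pos (by linarith)] at this
  linarith

theorem norm_cayley_I_sub_le {u v : ℂ} (hu : 0 < u.im) (hv : 0 < v.im) :
    ‖cayley Complex.I u - cayley Complex.I v‖ ≤ 2 * ‖u - v‖ := by
  rw [cayley_I_sub hu hv, norm_div, norm_mul, norm_mul, norm_mul]
  simp only [Complex.norm_I, Complex.norm_ofNat, mul_one]
  refine div_le_self (by positivity) ?_
  nlinarith [one_le_norm_add_I hu, one_le_norm_add_I hv]

/-- The inverse Cayley transform is Lipschitz only away from its pole; `η * M ≤ 1` forces `‖u + i‖ ≤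
2M`, which keeps `u` in a bounded set. -/
theorem norm_sub_le_of_cayley {u v : ℂ} {M η : ℝ} (hu : 0 < u.im) (hv : 0 < v.im)
    (hM : ‖v + Complex.I‖ ≤ M) (h : ‖cayley Complex.I u - cayley Complex.I v‖ ≤ η)
    (hη : η * M ≤ 1) : ‖u - v‖ ≤ η * M ^ 2 := by
  have a1 := one_le_norm_add_I hu
  have a2 := one_le_norm_add_I hv
  have hη0 : 0 ≤ η := (norm_nonneg _).trans h
  rw [cayley_I_sub hu hv, norm_div, norm_mul, norm_mul, norm_mul,
    div_le_iff₀ (by positivity)] at h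
  simp only [Complex.norm_I, Complex.norm_ofNat, mul_one] at h
  have a3 : ‖u + Complex.I‖ ≤ ‖u - v‖ + ‖v + Complex.I‖ := by
    rw [show u + Complex.I = (u - v) + (v + Complex.I) by ring]
    exact norm_add_le _ _
  have a4 : η * (‖u + Complex.I‖ * ‖v + Complex.I‖) ≤ η * M * ‖u + Complex.I‖ := by
    nlinarith [mul_le_mul_of_nonneg_left hM (mul_nonneg hη0 (norm_nonneg (u + Complex.I)))]
  have a5 : ‖u + Complex.I‖ ≤ 2 * M := by nlinarith
  have hM0 : 0 ≤ M := by linarith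
  nlinarith [mul_le_mul_of_nonneg_left a5 (mul_nonneg hη0 hM0)]

/-- The quotient `C ∘ G / C`, with `C` the Cayley transform at the fixed point `i` of `G`, extends
to a holomorphic map into the closed disc. -/
theorem exists_cayley_quotient {G : ℂ → ℂ} (hG : DifferentiableOn ℂ G upperHalfPlaneSet)
    (hm : Set.MapsTo G upperHalfPlaneSet upperHalfPlaneSet) (hI : G Complex.I = Complex.I) :
    ∃ h : ℂ → ℂ, DifferentiableOn ℂ h upperHalfPlaneSet ∧
      (∀ z ∈ upperHalfPlaneSet, ‖h z‖ ≤ 1) ∧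
      ∀ z ∈ upperHalfPlaneSet, cayley Complex.I (G z) = cayley Complex.I z * h z := by
  have hIm : (0 : ℝ) < Complex.I.im := by simp
  set g : ℂ → ℂ := cayley Complex.I ∘ G ∘ cayleyInv Complex.I with hgdef
  have hg : DifferentiableOn ℂ g (Metric.ball 0 1) :=
    (differentiableOn_cayley hIm).comp
      (hG.comp (differentiableOn_cayleyInv _) (mapsTo_cayleyInv hIm))
      (hm.comp (mapsTo_cayleyInv hIm))
  have hg0 : g 0 = 0 := by simp [hgdef, cayleyInv, hI, cayley]
  have hmaps : Set.MapsTo g (Metric.ball 0 1) (Metric.closedBall (g 0) 1) := by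
    intro ζ hζ
    rw [hg0, mem_closedBall_zero_iff]
    exact (pseudoHypDist_lt_one hIm (hm (mapsTo_cayleyInv hIm hζ))).le
  have hC : Set.MapsTo (cayley Complex.I) upperHalfPlaneSet (Metric.ball 0 1) := by
    intro z hz
    rw [mem_ball_zero_iff]
    exact pseudoHypDist_lt_one hIm hz
  refine ⟨dslope g 0 ∘ cayley Complex.I, ?_, fun z hz => ?_, fun z hz => ?_⟩
  · refine DifferentiableOn.comp ?_ (differentiableOn_cayley hIm) hC
    exact (Complex.differentiableOn_dslope (Metric.ball_mem_nhds 0 one_pos)).2 hg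
  · simpa using Complex.norm_dslope_le_div_of_mapsTo_ball hg hmaps (hC hz)
  · have := sub_smul_dslope g 0 (cayley Complex.I z)
    rw [hg0, sub_zero, sub_zero, smul_eq_mul] at this
    rw [Function.comp_apply, this, hgdef, Function.comp_apply, Function.comp_apply,
      cayleyInv_cayley hIm hz]

/-- With `h` the Cayley quotient of `G`, the deviation from the identity is measured by `h - 1`. It
is small at `p` when `G p` is near `p`, and since `1 - ‖h p‖ ^ 2 ≤ 2 ‖h p - 1‖`, rigidity carries
this to `z`. -/
theorem norm_cayley_map_sub_le {G : ℂ → ℂ} (hG : DifferentiableOn ℂ G upperHalfPlaneSet)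
    (hm : Set.MapsTo G upperHalfPlaneSet upperHalfPlaneSet) (hI : G Complex.I = Complex.I)
    {p z : ℂ} (hp : 0 < p.im) (hz : 0 < z.im) :
    ‖cayley Complex.I (G z) - cayley Complex.I z‖ *
        (‖cayley Complex.I p‖ * (1 - pseudoHypDist p z)) ≤ 4 * ‖G p - p‖ := by
  obtain ⟨h, hd, h1, hh⟩ := exists_cayley_quotient hG hm hI
  have hr := norm_sub_le_of_norm_le_one hd h1 hp hz
  set ρ := pseudoHypDist p z
  have hρ0 : 0 ≤ ρ := pseudoHypDist_nonneg _ _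
  have hρ1 : ρ < 1 := pseudoHypDist_lt_one hp hz
  have hC : ‖cayley Complex.I z‖ ≤ 1 := (pseudoHypDist_lt_one (by simp) hz).le
  have e1 : ∀ w, 0 < w.im → ‖cayley Complex.I (G w) - cayley Complex.I w‖
      = ‖cayley Complex.I w‖ * ‖h w - 1‖ := by
    intro w hw
    rw [hh w hw, ← norm_mul]
    congr 1; ring
  have e2 : 1 - ‖h p‖ ≤ ‖h p - 1‖ := by
    have := norm_sub_norm_le (1 : ℂ) (h p)
    rwa [norm_one, norm_sub_rev] at this
  have e3 : ‖h z - 1‖ ≤ ‖h z - h p‖ + ‖h p - 1‖ := by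
    have := norm_add_le (h z - h p) (h p - 1)
    simpa using this
  have hp1 := h1 p hp
  have e4 : 1 - ‖h p‖ ^ 2 ≤ 2 * ‖h p - 1‖ := by nlinarith [norm_nonneg (h p)]
  have e5 : ‖h z - 1‖ * (1 - ρ) ≤ 2 * ‖h p - 1‖ := by
    have := norm_nonneg (h p - 1)
    have a := mul_le_mul_of_nonneg_right e3 (by linarith : 0 ≤ 1 - ρ)
    have b := mul_le_mul_of_nonneg_left e4 hρ0
    have c : ρ * ‖h p - 1‖ ≤ ‖h p - 1‖ := by nlinarith
    nlinarith
  have e6 := norm_cayley_I_sub_le (hm hp) hp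
  rw [e1 p hp] at e6
  rw [e1 z hz]
  calc ‖cayley Complex.I z‖ * ‖h z - 1‖ * (‖cayley Complex.I p‖ * (1 - ρ))
      = ‖cayley Complex.I z‖ * ‖cayley Complex.I p‖ * (‖h z - 1‖ * (1 - ρ)) := by ring
    _ ≤ 1 * ‖cayley Complex.I p‖ * (2 * ‖h p - 1‖) := by
        gcongr
    _ ≤ 4 * ‖G p - p‖ := by linarith

theorem continuousOn_pseudoHypDist : ContinuousOn (fun x : ℂ × ℂ => pseudoHypDist x.1 x.2)
    (upperHalfPlaneSet ×ˢ upperHalfPlaneSet) := by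
  unfold pseudoHypDist
  refine ContinuousOn.norm (ContinuousOn.div (by fun_prop) ?_ fun x hx =>
    sub_conj_ne_zero hx.1 hx.2)
  exact (continuous_snd.sub (Complex.continuous_conj.comp continuous_fst)).continuousOn

theorem exists_pseudoHypDist_le {K L : Set ℂ} (hK : IsCompact K) (hL : IsCompact L)
    (hKs : K ⊆ upperHalfPlaneSet) (hLs : L ⊆ upperHalfPlaneSet) :
    ∃ r, 0 ≤ r ∧ r < 1 ∧ ∀ p ∈ K, ∀ z ∈ L, pseudoHypDist p z ≤ r := by
  rcases (K ×ˢ L).eq_empty_or_nonempty with h | h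
  · refine ⟨0, le_rfl, one_pos, fun p hp z hz => ?_⟩
    have : (p, z) ∈ K ×ˢ L := ⟨hp, hz⟩
    rw [h] at this
    exact this.elim
  · obtain ⟨x, hx, hmax⟩ := (hK.prod hL).exists_isMaxOn h
      (continuousOn_pseudoHypDist.mono (Set.prod_mono hKs hLs))
    exact ⟨_, pseudoHypDist_nonneg x.1 x.2, pseudoHypDist_lt_one (hKs hx.1) (hLs hx.2),
      fun p hp z hz => hmax (show (p, z) ∈ K ×ˢ L from ⟨hp, hz⟩)⟩

/-- Self-maps of the half-plane fixing `i` and almost fixing a second point are uniformly close to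
the identity on compact sets. -/
theorem exists_forall_norm_map_sub_lt {K : Set ℂ} (hK : IsCompact K) (hKs : K ⊆ upperHalfPlaneSet)
    {p₀ : ℂ} (hp₀ : 0 < p₀.im) (hne : p₀ ≠ Complex.I) {ε : ℝ} (hε : 0 < ε) :
    ∃ δ > 0, ∀ G : ℂ → ℂ, DifferentiableOn ℂ G upperHalfPlaneSet →
      Set.MapsTo G upperHalfPlaneSet upperHalfPlaneSet → G Complex.I = Complex.I →
      ∀ p, 0 < p.im → ‖p - p₀‖ < δ → ‖G p - p₀‖ < δ → ∀ z ∈ K, ‖G z - z‖ < ε := by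
  have hopen : IsOpen upperHalfPlaneSet := isOpen_upperHalfPlaneSet
  obtain ⟨δ₀, hδ₀, hball⟩ := Metric.nhds_basis_closedBall.mem_iff.1 (hopen.mem_nhds hp₀)
  obtain ⟨r, hr0, hr1, hr⟩ := exists_pseudoHypDist_le (isCompact_closedBall p₀ δ₀) hK hball hKs
  set c := ‖cayley Complex.I p₀‖ with hc
  have hc0 : 0 < c := by
    refine lt_of_le_of_ne (norm_nonneg _) fun h => hne ?_
    exact eq_of_pseudoHypDist_eq_zero (by simp) hp₀ h.symm
  obtain ⟨M, hM⟩ := hK.isBounded.exists_norm_le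
  set M' := |M| + 1 with hM'
  have hM'0 : 0 < M' := by positivity
  obtain ⟨η, hη0, hη1, hη2⟩ : ∃ η > 0, η * M' ≤ 1 ∧ η * M' ^ 2 < ε := by
    refine ⟨min (1 / M') (ε / (2 * M' ^ 2)), by positivity, ?_, ?_⟩
    · calc _ ≤ 1 / M' * M' := by gcongr; exact min_le_left _ _
        _ = 1 := by field_simp
    · calc _ ≤ ε / (2 * M' ^ 2) * M' ^ 2 := by gcongr; exact min_le_right _ _
        _ = ε / 2 := by field_simp
        _ < ε := by linarith
  -- `δ₀` keeps `p` in a compact set, so its distances to `K` are at most `r`; `c / 4` keeps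
  -- `‖cayley i p‖ ≥ c / 2`; the last term makes the Cayley displacement at most `η`.
  refine ⟨min (min δ₀ (c / 4)) (η * (c / 2 * (1 - r)) / 8), ?_, ?_⟩
  · have : 0 < 1 - r := by linarith
    positivity
  intro G hG hm hI p hp hp1 hp2 z hz
  simp only [lt_min_iff] at hp1 hp2
  have h1 : ‖G p - p‖ < 2 * (η * (c / 2 * (1 - r)) / 8) := by
    have := norm_sub_le (G p - p₀) (p - p₀)
    rw [sub_sub_sub_cancel_right] at this
    linarith [hp1.2, hp2.2]
  have h2 : c / 2 ≤ ‖cayley Complex.I p‖ := by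
    have a := norm_cayley_I_sub_le hp₀ hp
    rw [norm_sub_rev p₀ p] at a
    have b := norm_sub_norm_le (cayley Complex.I p₀) (cayley Complex.I p)
    linarith [hp1.1.2]
  have h3 : pseudoHypDist p z ≤ r := hr p (by
    rw [mem_closedBall_iff_norm]; exact hp1.1.1.le) z hz
  have h4 := norm_cayley_map_sub_le hG hm hI hp (hKs hz)
  have h5 : ‖cayley Complex.I (G z) - cayley Complex.I z‖ ≤ η := by
    have a : c / 2 * (1 - r) ≤ ‖cayley Complex.I p‖ * (1 - pseudoHypDist p z) := by
      gcongr
    have b : 0 < c / 2 * (1 - r) := mul_pos (by linarith) (by linarith)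
    have d := mul_le_mul_of_nonneg_left a (norm_nonneg (cayley Complex.I (G z) - cayley Complex.I z))
    refine le_of_mul_le_mul_right ?_ b
    linarith
  refine (norm_sub_le_of_cayley (hm (hKs hz)) (hKs hz) ?_ h5 hη1).trans_lt hη2
  refine (norm_add_le _ _).trans ?_
  rw [Complex.norm_I]
  linarith [hM z hz, le_abs_self M]

/-! ### Asymptotics of the steps of the backward sequence -/

theorem differentiableOn_iterate {φ : ℂ → ℂ} (hd : DifferentiableOn ℂ φ upperHalfPlaneSet)
    (hm : Set.MapsTo φ upperHalfPlaneSet upperHalfPlaneSet) (n : ℕ) :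
    DifferentiableOn ℂ φ^[n] upperHalfPlaneSet := by
  induction n with
  | zero => exact differentiableOn_id
  | succ k ih => rw [Function.iterate_succ]; exact ih.comp hd hm

theorem iterate_backward {φ : ℂ → ℂ} {w : ℕ → ℂ} (h : ∀ n, φ (w (n + 1)) = w n) (m k : ℕ) :
    φ^[k] (w (m + k)) = w m := by
  induction k with
  | zero => rfl
  | succ k ih => rw [Function.iterate_succ_apply, ← add_assoc, h, ih]

/-- `φ` contracts distances and lowers both indices by one. -/
theorem monotone_pseudoHypDist {φ : ℂ → ℂ} {w : ℕ → ℂ}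
    (hd : DifferentiableOn ℂ φ upperHalfPlaneSet)
    (hm : Set.MapsTo φ upperHalfPlaneSet upperHalfPlaneSet)
    (hw : IsBISBS φ w) (k : ℕ) : Monotone fun n => pseudoHypDist (w n) (w (n + k)) := by
  refine monotone_nat_of_le_succ fun n => ?_
  have := pseudoHypDist_map_le hd hm (hw.mem (n + 1)) (hw.mem (n + k + 1))
  rw [hw.backward, hw.backward] at this
  rwa [add_right_comm] at this

theorem tendsto_re_atTop {w : ℕ → ℂ} (hw : Tendsto w atTop (Bornology.cobounded ℂ))
    (harg : Tendsto (fun n => (w n).arg) atTop (𝓝 0)) :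
    Tendsto (fun n => (w n).re) atTop atTop := by
  have h1 : Tendsto (fun n => ‖w n‖) atTop atTop := tendsto_norm_atTop_iff_cobounded.2 hw
  have h2 : Tendsto (fun n => Real.cos (w n).arg) atTop (𝓝 1) := by
    have := (Real.continuous_cos.tendsto 0).comp harg
    rwa [Real.cos_zero] at this
  exact (h1.atTop_mul_pos one_pos h2).congr fun n => Complex.norm_mul_cos_arg _

theorem sq_pseudoHypDist_mul {p z : ℂ} (hp : 0 < p.im) (hz : 0 < z.im) :
    pseudoHypDist p z ^ 2 * ((z.re - p.re) ^ 2 + (z.im + p.im) ^ 2)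
      = (z.re - p.re) ^ 2 + (z.im - p.im) ^ 2 := by
  have h := congrArg (· ^ 2) (pseudoHypDist_mul hp hz)
  simp only [mul_pow, ← Complex.normSq_eq_norm_sq] at h
  simp only [Complex.normSq_apply, Complex.sub_re, Complex.sub_im, Complex.conj_re,
    Complex.conj_im, sub_neg_eq_add] at h
  linear_combination h

theorem pseudoHypDist_le_div {p z : ℂ} {l : ℝ} (hl : 0 < l) (hp : 0 < p.im) (hz : l ≤ z.im) :
    pseudoHypDist p z ≤ ‖z - p‖ / l := by
  rw [le_div_iff₀ hl, ← pseudoHypDist_mul hp (hl.trans_le hz)]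
  refine mul_le_mul_of_nonneg_left ?_ (pseudoHypDist_nonneg _ _)
  have := Complex.abs_im_le_norm (z - (starRingEnd ℂ) p)
  simp only [Complex.sub_im, Complex.conj_im, sub_neg_eq_add] at this
  linarith [le_abs_self (z.im + p.im)]

/-- The steps increase to their supremum; were it `0`, every step would vanish and `w` would be
constant. -/
theorem exists_tendsto_pseudoHypDist {φ : ℂ → ℂ} {w : ℕ → ℂ}
    (hd : DifferentiableOn ℂ φ upperHalfPlaneSet)
    (hm : Set.MapsTo φ upperHalfPlaneSet upperHalfPlaneSet) (hw : IsBISBS φ w) :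
    ∃ a, 0 < a ∧ a < 1 ∧
      Tendsto (fun n => pseudoHypDist (w n) (w (n + 1))) atTop (𝓝 a) := by
  obtain ⟨s, hs1, hs⟩ := hw.bounded_steps
  have hmono := monotone_pseudoHypDist hd hm hw 1
  have hbdd : BddAbove (Set.range fun n => pseudoHypDist (w n) (w (n + 1))) :=
    ⟨s, by rintro _ ⟨n, rfl⟩; exact hs n⟩
  have hlim := tendsto_atTop_ciSup hmono hbdd
  refine ⟨_, ?_, (ciSup_le hs).trans_lt hs1, hlim⟩
  by_contra! hle
  have hz : ∀ n, w (n + 1) = w n := fun n =>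
    eq_of_pseudoHypDist_eq_zero (hw.mem _) (hw.mem _)
      (le_antisymm ((le_ciSup hbdd n).trans hle) (pseudoHypDist_nonneg _ _))
  obtain ⟨n, hn⟩ := hw.nontrivial
  refine hn ?_
  clear hn
  induction n with
  | zero => rfl
  | succ k ih => rw [hz, ih]

/-- The step length and the two heights determine the horizontal increment only up to sign; the sign
is settled by `eventually_re_increment_pos`. -/
theorem tendsto_sq_re_sub {w : ℕ → ℂ} (hw : ∀ n, w n ∈ upperHalfPlaneSet) {l a : ℝ}
    (ha0 : 0 ≤ a) (ha1 : a < 1) (hy : Tendsto (fun n => (w n).im) atTop (𝓝 l))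
    (ha : Tendsto (fun n => pseudoHypDist (w n) (w (n + 1))) atTop (𝓝 a)) :
    Tendsto (fun n => ((w (n + 1)).re - (w n).re) ^ 2) atTop
      (𝓝 ((a ^ 2 * (l + l) ^ 2 - (l - l) ^ 2) / (1 - a ^ 2))) := by
  have hy1 : Tendsto (fun n => (w (n + 1)).im) atTop (𝓝 l) := hy.comp (tendsto_add_atTop_nat 1)
  have hden : 1 - a ^ 2 ≠ 0 := by nlinarith
  have := (((ha.pow 2).mul ((hy1.add hy).pow 2)).sub ((hy1.sub hy).pow 2)).div
    ((ha.pow 2).const_sub 1) hden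
  refine this.congr fun n => ?_
  have h1 := sq_pseudoHypDist_mul (hw n) (hw (n + 1))
  have h2 := pseudoHypDist_lt_one (hw n) (hw (n + 1))
  have h3 := pseudoHypDist_nonneg (w n) (w (n + 1))
  have h4 : 0 < 1 - pseudoHypDist (w n) (w (n + 1)) ^ 2 := by nlinarith
  simp only [Pi.div_apply]
  rw [div_eq_iff h4.ne']
  linear_combination h1

/-- A sequence tending to `+∞` whose consecutive increments eventually have the same sign is
eventually increasing. -/
theorem eventually_increment_pos {x : ℕ → ℝ} (hx : Tendsto x atTop atTop)
    (h : ∀ᶠ n in atTop, 0 < (x (n + 1) - x n) * (x (n + 2) - x (n + 1))) :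
    ∀ᶠ n in atTop, 0 < x (n + 1) - x n := by
  obtain ⟨N, hN⟩ := eventually_atTop.1 h
  filter_upwards [eventually_ge_atTop N] with n hn
  by_contra! hneg
  have hneg' : ∀ k, x (n + k + 1) - x (n + k) < 0 := by
    intro k
    induction k with
    | zero =>
      have := hN n hn
      rcases pos_and_pos_or_neg_and_neg_of_mul_pos this with h1 | h1
      · exact absurd h1.1 (not_lt.2 hneg)
      · exact h1.1
    | succ k ih =>
      have := hN (n + k) (by omega)
      rcases pos_and_pos_or_neg_and_neg_of_mul_pos this with h1 | h1
      · exact absurd h1.1 (not_lt.2 ih.le)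
      · exact h1.2
  have hbound : ∀ k, x (n + k) ≤ x n := by
    intro k
    induction k with
    | zero => exact le_rfl
    | succ k ih => rw [← add_assoc]; linarith [hneg' k]
  obtain ⟨M, hM⟩ := eventually_atTop.1 (hx.eventually_gt_atTop (x n))
  exact absurd (hM (n + M) (by omega)) (not_lt.2 (hbound M))

/-- A backward-iteration sequence going to infinity at positive height cannot turn back
infinitely often. -/
theorem eventually_re_increment_pos {φ : ℂ → ℂ} {w : ℕ → ℂ}
    (hd : DifferentiableOn ℂ φ upperHalfPlaneSet)
    (hm : Set.MapsTo φ upperHalfPlaneSet upperHalfPlaneSet) (hw : IsBISBS φ w)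
    (hx : Tendsto (fun n => (w n).re) atTop atTop) {l s : ℝ} (hl : 0 < l) (hs : 0 < s)
    (hy : Tendsto (fun n => (w n).im) atTop (𝓝 l))
    (habs : Tendsto (fun n => |(w (n + 1)).re - (w n).re|) atTop (𝓝 s)) :
    ∀ᶠ n in atTop, 0 < (w (n + 1)).re - (w n).re := by
  obtain ⟨N, hN⟩ : ∃ N, w (N + 2) ≠ w N := by
    by_contra! h
    obtain ⟨M, hM⟩ := eventually_atTop.1 (hx.eventually_gt_atTop (w 0).re)
    have h2 : ∀ k, w (2 * k) = w 0 := by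
      intro k
      induction k with
      | zero => rfl
      | succ k ih => rw [mul_add, mul_one, h, ih]
    have := hM (2 * M) (by omega)
    rw [h2] at this
    exact lt_irrefl _ this
  -- By monotonicity, `c` bounds every later two-step distance from below.
  set c := pseudoHypDist (w N) (w (N + 2)) with hc
  have hc0 : 0 < c := lt_of_le_of_ne (pseudoHypDist_nonneg _ _) fun h =>
    hN (eq_of_pseudoHypDist_eq_zero (hw.mem _) (hw.mem _) h.symm)
  have hy2 : Tendsto (fun n => (w (n + 2)).im) atTop (𝓝 l) := hy.comp (tendsto_add_atTop_nat 2)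
  have hdy : Tendsto (fun n => |(w (n + 2)).im - (w n).im|) atTop (𝓝 0) := by
    have := (hy2.sub hy).abs
    rwa [sub_self, abs_zero] at this
  have habs1 : Tendsto (fun n => |(w (n + 2)).re - (w (n + 1)).re|) atTop (𝓝 s) :=
    habs.comp (tendsto_add_atTop_nat 1)
  have hdiff : Tendsto (fun n => |(|(w (n + 2)).re - (w (n + 1)).re| -
      |(w (n + 1)).re - (w n).re|)|) atTop (𝓝 0) := by
    have := (habs1.sub habs).abs
    rwa [sub_self, abs_zero] at this
  have hcl : 0 < c * (l / 2) / 2 := by positivity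
  refine eventually_increment_pos hx ?_
  filter_upwards [eventually_ge_atTop N, hy2.eventually_const_le (half_lt_self hl),
    hdy.eventually_lt_const hcl, hdiff.eventually_lt_const hcl, habs.eventually_const_lt hs,
    habs1.eventually_const_lt hs] with n hn h1 h2 h3 h4 h5
  have h6 : c ≤ ‖w (n + 2) - w n‖ / (l / 2) :=
    (monotone_pseudoHypDist hd hm hw 2 hn).trans
      (pseudoHypDist_le_div (half_pos hl) (hw.mem n) h1)
  rw [le_div_iff₀ (half_pos hl)] at h6
  have h7 := Complex.norm_le_abs_re_add_abs_im (w (n + 2) - w n)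
  rw [Complex.sub_re, Complex.sub_im] at h7
  have h8 : c * (l / 2) / 2 < |(w (n + 2)).re - (w n).re| := by linarith
  -- Increments of opposite signs would make the two-step displacement equal, up to sign, to the
  -- difference of their absolute values, which is too small for `h8`.
  by_contra! hle
  refine absurd h8 (not_lt.2 (le_trans ?_ h3.le))
  have e : (w (n + 2)).re - (w n).re
    = ((w (n + 2)).re - (w (n + 1)).re) + ((w (n + 1)).re - (w n).re) := by ring
  rw [e]
  rcases abs_cases ((w (n + 2)).re - (w (n + 1)).re) with ⟨p1, q1⟩ | ⟨p1, q1⟩ <;>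
  rcases abs_cases ((w (n + 1)).re - (w n).re) with ⟨p2, q2⟩ | ⟨p2, q2⟩ <;>
  rw [p1] at h5 ⊢ <;> rw [p2] at h4 ⊢
  · nlinarith
  · exact (congrArg abs (by ring)).le
  · rw [← abs_neg]; exact (congrArg abs (by ring)).le
  · nlinarith

theorem exists_step_asymptotics {φ : ℂ → ℂ} {w : ℕ → ℂ}
    (hd : DifferentiableOn ℂ φ upperHalfPlaneSet)
    (hm : Set.MapsTo φ upperHalfPlaneSet upperHalfPlaneSet) (hw : IsBISBS φ w)
    (hx : Tendsto (fun n => (w n).re) atTop atTop) {l : ℝ} (hl : 0 < l)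
    (hy : Tendsto (fun n => (w n).im) atTop (𝓝 l)) :
    ∃ a b : ℝ, a < 1 ∧ 0 < b ∧ b = 2 * a / Real.sqrt (1 - a ^ 2) ∧
      Tendsto (fun n => pseudoHypDist (w n) (w (n + 1))) atTop (𝓝 a) ∧
      Tendsto (fun n => (w (n + 1)).re - (w n).re) atTop (𝓝 (l * b)) := by
  obtain ⟨a, ha0, ha1, ha⟩ := exists_tendsto_pseudoHypDist hd hm hw
  have h1 : 0 < 1 - a ^ 2 := by nlinarith
  have hb : 0 < 2 * a / Real.sqrt (1 - a ^ 2) := by positivity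
  refine ⟨a, _, ha1, hb, rfl, ha, ?_⟩
  have habs : Tendsto (fun n => |(w (n + 1)).re - (w n).re|) atTop
      (𝓝 (l * (2 * a / Real.sqrt (1 - a ^ 2)))) := by
    have hlim := (Real.continuous_sqrt.tendsto _).comp (tendsto_sq_re_sub hw.mem ha0.le ha1 hy ha)
    have hsqrt : Real.sqrt ((a ^ 2 * (l + l) ^ 2 - (l - l) ^ 2) / (1 - a ^ 2))
        = l * (2 * a / Real.sqrt (1 - a ^ 2)) := by
      rw [Real.sqrt_eq_iff_mul_self_eq_of_pos (by positivity)]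
      field_simp
      rw [Real.sq_sqrt h1.le]
      ring
    rw [hsqrt] at hlim
    exact hlim.congr fun n => Real.sqrt_sq_eq_abs _
  have hpos := eventually_re_increment_pos hd hm hw hx hl (mul_pos hl hb) hy habs
  refine habs.congr' ?_
  filter_upwards [hpos] with n hn
  exact abs_of_pos hn

/-! ### Euclidean bounds on hyperbolic discs, and the automorphisms `τ_p` -/

/-- This follows from `‖z - p̄‖ ≤ ‖z - p‖ + 2 Im p`: Euclidean displacement is controlled by
hyperbolic distance times height. -/
theorem norm_sub_mul_le_im {p z : ℂ} {r : ℝ} (hp : 0 < p.im) (hz : 0 < z.im)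
    (h : pseudoHypDist p z ≤ r) : ‖z - p‖ * (1 - r) ≤ 2 * r * p.im := by
  have h1 : ‖z - (starRingEnd ℂ) p‖ ≤ ‖z - p‖ + 2 * p.im := by
    apply (sq_le_sq₀ (norm_nonneg _) (by positivity)).1
    have h2 : z.im - p.im ≤ ‖z - p‖ := by
      have := Complex.abs_im_le_norm (z - p)
      rw [Complex.sub_im] at this
      exact (le_abs_self _).trans this
    rw [normSq_sub_conj]
    nlinarith
  have h3 := pseudoHypDist_mul hp hz
  have h4 : 0 ≤ r := (pseudoHypDist_nonneg _ _).trans h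
  have h5 := mul_le_mul h h1 (norm_nonneg _) h4
  linarith

theorem im_mul_le_im {p z : ℂ} {r : ℝ} (hp : 0 < p.im) (hz : 0 < z.im) (hr : r < 1)
    (h : pseudoHypDist p z ≤ r) : p.im * (1 - r) ≤ (1 + r) * z.im := by
  rw [pseudoHypDist_comm] at h
  have h1 := norm_sub_mul_le_im hz hp h
  have h2 : p.im - z.im ≤ ‖p - z‖ := by
    have := Complex.abs_im_le_norm (p - z)
    rw [Complex.sub_im] at this
    exact (le_abs_self _).trans this
  nlinarith

theorem exists_le_im_of_isCompact {K : Set ℂ} (hK : IsCompact K) (hKs : K ⊆ upperHalfPlaneSet) :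
    ∃ c > 0, ∀ z ∈ K, c ≤ z.im := by
  rcases K.eq_empty_or_nonempty with rfl | hne
  · exact ⟨1, one_pos, by simp⟩
  · obtain ⟨x, hx, hmin⟩ := hK.exists_isMinOn hne Complex.continuous_im.continuousOn
    exact ⟨x.im, hKs hx, fun z hz => hmin hz⟩

theorem halfPlaneAut_im (p z : ℂ) : (halfPlaneAut p z).im = p.im * z.im := by
  simp [halfPlaneAut]

theorem halfPlaneAut_I (p : ℂ) : halfPlaneAut p Complex.I = p := by
  simp [halfPlaneAut]

theorem mapsTo_halfPlaneAut {p : ℂ} (hp : 0 < p.im) :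
    Set.MapsTo (halfPlaneAut p) upperHalfPlaneSet upperHalfPlaneSet := fun z hz => by
  rw [mem_uhp, halfPlaneAut_im]
  exact mul_pos hp hz

theorem differentiable_halfPlaneAut (p : ℂ) : Differentiable ℂ (halfPlaneAut p) := by
  unfold halfPlaneAut
  fun_prop

/-- The inverse of `halfPlaneAut p`. -/
noncomputable def halfPlaneAutInv (p z : ℂ) : ℂ := (z - p.re) / p.im

theorem halfPlaneAut_inv {p : ℂ} (hp : 0 < p.im) (z : ℂ) :
    halfPlaneAut p (halfPlaneAutInv p z) = z := by
  have : (p.im : ℂ) ≠ 0 := by exact_mod_cast hp.ne'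
  rw [halfPlaneAut, halfPlaneAutInv, mul_div_cancel₀ _ this]
  ring

theorem halfPlaneAutInv_aut {p : ℂ} (hp : 0 < p.im) (z : ℂ) :
    halfPlaneAutInv p (halfPlaneAut p z) = z := by
  have : (p.im : ℂ) ≠ 0 := by exact_mod_cast hp.ne'
  rw [halfPlaneAut, halfPlaneAutInv]
  field_simp
  ring

theorem halfPlaneAutInv_self {p : ℂ} (hp : 0 < p.im) : halfPlaneAutInv p p = Complex.I := by
  conv_lhs => rw [← halfPlaneAut_I p]
  rw [halfPlaneAut_I p, ← halfPlaneAutInv_aut hp Complex.I, halfPlaneAut_I]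

theorem mapsTo_halfPlaneAutInv {p : ℂ} (hp : 0 < p.im) :
    Set.MapsTo (halfPlaneAutInv p) upperHalfPlaneSet upperHalfPlaneSet := fun z hz => by
  rw [mem_uhp, halfPlaneAutInv, Complex.div_ofReal_im]
  simpa using div_pos hz hp

theorem differentiable_halfPlaneAutInv (p : ℂ) : Differentiable ℂ (halfPlaneAutInv p) := by
  unfold halfPlaneAutInv
  fun_prop

/-! ### Convergence of the normalized iterates to the conjugation -/

section Sequence

variable {φ : ℂ → ℂ} {w : ℕ → ℂ} {l b : ℝ}

theorem differentiableOn_iterate_aut (hd : DifferentiableOn ℂ φ upperHalfPlaneSet)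
    (hm : Set.MapsTo φ upperHalfPlaneSet upperHalfPlaneSet) (hw : IsBISBS φ w) (k n : ℕ) :
    DifferentiableOn ℂ (fun z => φ^[k] (halfPlaneAut (w n) z)) upperHalfPlaneSet :=
  (differentiableOn_iterate hd hm k).comp (differentiable_halfPlaneAut _).differentiableOn
    (mapsTo_halfPlaneAut (hw.mem n))

theorem mapsTo_iterate_aut (hm : Set.MapsTo φ upperHalfPlaneSet upperHalfPlaneSet)
    (hw : IsBISBS φ w) (k n : ℕ) :
    Set.MapsTo (fun z => φ^[k] (halfPlaneAut (w n) z)) upperHalfPlaneSet upperHalfPlaneSet :=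
  (hm.iterate k).comp (mapsTo_halfPlaneAut (hw.mem n))

theorem pseudoHypDist_iterate_aut_le (hd : DifferentiableOn ℂ φ upperHalfPlaneSet)
    (hm : Set.MapsTo φ upperHalfPlaneSet upperHalfPlaneSet) (hw : IsBISBS φ w) (n : ℕ)
    {z : ℂ} (hz : 0 < z.im) :
    pseudoHypDist (w 0) (φ^[n] (halfPlaneAut (w n) z)) ≤ pseudoHypDist Complex.I z := by
  have := pseudoHypDist_map_le (differentiableOn_iterate_aut hd hm hw n n)
    (mapsTo_iterate_aut hm hw n n) (p := Complex.I) (by simp) hz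
  have h0 := iterate_backward hw.backward 0 n
  rw [zero_add] at h0
  rwa [halfPlaneAut_I, h0] at this

theorem tendsto_re_sub_re (hx : Tendsto (fun n => (w (n + 1)).re - (w n).re) atTop (𝓝 b))
    (m : ℕ) : Tendsto (fun n => (w (m + n)).re - (w n).re) atTop (𝓝 (m * b)) := by
  induction m with
  | zero => simp
  | succ k ih =>
    have h1 : Tendsto (fun n => (w (n + k + 1)).re - (w (n + k)).re) atTop (𝓝 b) :=
      hx.comp (tendsto_add_atTop_nat k)
    have := h1.add ih
    push_cast
    rw [add_mul, one_mul, add_comm (k * b)]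
    refine this.congr fun n => ?_
    rw [show k + 1 + n = n + k + 1 by ring, show k + n = n + k by ring]
    ring

theorem tendsto_autInv_aut (hl : 0 < l) (hy : Tendsto (fun n => (w n).im) atTop (𝓝 l))
    (hx : Tendsto (fun n => (w (n + 1)).re - (w n).re) atTop (𝓝 (l * b))) (m : ℕ) (z : ℂ) :
    Tendsto (fun n => halfPlaneAutInv (w n) (halfPlaneAut (w (m + n)) z)) atTop
      (𝓝 (z + m * b)) := by
  have hl' : (l : ℂ) ≠ 0 := by exact_mod_cast hl.ne'
  have h1 : Tendsto (fun n => (((w (m + n)).re - (w n).re : ℝ) : ℂ)) atTop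
      (𝓝 ((m * (l * b) : ℝ) : ℂ)) :=
    (Complex.continuous_ofReal.tendsto _).comp (tendsto_re_sub_re hx m)
  have h2 : Tendsto (fun n => ((w n).im : ℂ)) atTop (𝓝 (l : ℂ)) :=
    (Complex.continuous_ofReal.tendsto _).comp hy
  have h3 : Tendsto (fun n => ((w (m + n)).im : ℂ)) atTop (𝓝 (l : ℂ)) := by
    simp_rw [add_comm m]
    exact h2.comp (tendsto_add_atTop_nat m)
  have h4 := (h1.add (h3.mul_const z)).div h2 hl'
  have e : (((m * (l * b) : ℝ) : ℂ) + l * z) / l = z + m * b := by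
    push_cast
    field_simp
    ring
  rw [e] at h4
  refine h4.congr fun n => ?_
  simp only [Pi.div_apply, halfPlaneAutInv, halfPlaneAut]
  push_cast
  ring

theorem tendsto_autInv_aut_succ (hl : 0 < l) (hy : Tendsto (fun n => (w n).im) atTop (𝓝 l))
    (hx : Tendsto (fun n => (w (n + 1)).re - (w n).re) atTop (𝓝 (l * b))) (z : ℂ) :
    Tendsto (fun n => halfPlaneAutInv (w (n + 1)) (halfPlaneAut (w n) z)) atTop
      (𝓝 (z - b)) := by
  have hl' : (l : ℂ) ≠ 0 := by exact_mod_cast hl.ne'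
  have h1 : Tendsto (fun n => (((w (n + 1)).re - (w n).re : ℝ) : ℂ)) atTop
      (𝓝 ((l * b : ℝ) : ℂ)) := (Complex.continuous_ofReal.tendsto _).comp hx
  have h2 : Tendsto (fun n => ((w n).im : ℂ)) atTop (𝓝 (l : ℂ)) :=
    (Complex.continuous_ofReal.tendsto _).comp hy
  have h3 : Tendsto (fun n => ((w (n + 1)).im : ℂ)) atTop (𝓝 (l : ℂ)) :=
    h2.comp (tendsto_add_atTop_nat 1)
  have h4 := ((h2.mul_const z).sub h1).div h3 hl'
  have e : (l * z - ((l * b : ℝ) : ℂ)) / l = z - b := by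
    push_cast
    field_simp
  rw [e] at h4
  refine h4.congr fun n => ?_
  simp only [Pi.div_apply, halfPlaneAutInv, halfPlaneAut]
  push_cast
  ring

/-- The normalized iterates `τ_m⁻¹ ∘ φ_k ∘ τ_{m+k}` are close to the identity for large `m`,
uniformly in `k`. -/
theorem exists_forall_norm_normalized_sub_lt (hd : DifferentiableOn ℂ φ upperHalfPlaneSet)
    (hm : Set.MapsTo φ upperHalfPlaneSet upperHalfPlaneSet) (hw : IsBISBS φ w)
    (hl : 0 < l) (hb : 0 < b) (hy : Tendsto (fun n => (w n).im) atTop (𝓝 l))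
    (hx : Tendsto (fun n => (w (n + 1)).re - (w n).re) atTop (𝓝 (l * b)))
    {K : Set ℂ} (hK : IsCompact K) (hKs : K ⊆ upperHalfPlaneSet) {ε : ℝ} (hε : 0 < ε) :
    ∃ M, ∀ m ≥ M, ∀ k, ∀ z ∈ K,
      ‖halfPlaneAutInv (w m) (φ^[k] (halfPlaneAut (w (m + k)) z)) - z‖ < ε := by
  obtain ⟨δ, hδ, hG⟩ := exists_forall_norm_map_sub_lt hK hKs (p₀ := Complex.I + b) (by simp)
    (by simpa using hb.ne') hε
  have hq : Tendsto (fun n => halfPlaneAutInv (w n) (w (n + 1))) atTop (𝓝 (Complex.I + b)) := by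
    have := tendsto_autInv_aut hl hy hx 1 Complex.I
    simp only [halfPlaneAut_I, Nat.cast_one, one_mul] at this
    simpa only [add_comm 1] using this
  obtain ⟨M, hM⟩ := eventually_atTop.1 (Metric.tendsto_nhds.1 hq δ hδ)
  simp only [dist_eq_norm] at hM
  refine ⟨M, fun m hmM k => ?_⟩
  refine hG (fun z => halfPlaneAutInv (w m) (φ^[k] (halfPlaneAut (w (m + k)) z)))
    ((differentiable_halfPlaneAutInv _).comp_differentiableOn
      (differentiableOn_iterate_aut hd hm hw k (m + k)))
    ((mapsTo_halfPlaneAutInv (hw.mem m)).comp (mapsTo_iterate_aut hm hw k (m + k))) ?_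
    -- The almost fixed point: its image is `τ_m⁻¹(w_{m+1})`, and both are within `δ` of `i + b`.
    (halfPlaneAutInv (w (m + k)) (w (m + k + 1)))
    (mapsTo_halfPlaneAutInv (hw.mem _) (hw.mem _)) (hM (m + k) (by omega)) ?_
  · simp only [halfPlaneAut_I, iterate_backward hw.backward, halfPlaneAutInv_self (hw.mem m)]
  · rw [halfPlaneAut_inv (hw.mem _), add_right_comm, iterate_backward hw.backward]
    exact hM m hmM

/-- Each later iterate is the `M`-th one precomposed with a map close to the identity. Schwarz-Pick,
with the uniform height bound `B`, turns closeness in the domain into Euclidean closeness of values.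
-/
theorem uniformCauchySeqOn_iterate_aut (hd : DifferentiableOn ℂ φ upperHalfPlaneSet)
    (hm : Set.MapsTo φ upperHalfPlaneSet upperHalfPlaneSet) (hw : IsBISBS φ w)
    (hl : 0 < l) (hb : 0 < b) (hy : Tendsto (fun n => (w n).im) atTop (𝓝 l))
    (hx : Tendsto (fun n => (w (n + 1)).re - (w n).re) atTop (𝓝 (l * b)))
    {K : Set ℂ} (hK : IsCompact K) (hKs : K ⊆ upperHalfPlaneSet) :
    UniformCauchySeqOn (fun n z => φ^[n] (halfPlaneAut (w n) z)) atTop K := by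
  obtain ⟨r, hr0, hr1, hr⟩ := exists_pseudoHypDist_le (isCompact_singleton (x := Complex.I)) hK
    (by simp) hKs
  replace hr := hr Complex.I rfl
  obtain ⟨c, hc0, hc⟩ := exists_le_im_of_isCompact hK hKs
  have hr1' : 0 < 1 - r := by linarith
  set B := (w 0).im + 2 * r * (w 0).im / (1 - r) with hB
  have hw0 : 0 < (w 0).im := hw.mem 0
  have hB0 : 0 < B := by positivity
  have hBound : ∀ n, ∀ z ∈ K, (φ^[n] (halfPlaneAut (w n) z)).im ≤ B := by
    intro n z hz
    have h1 := norm_sub_mul_le_im hw0 (mapsTo_iterate_aut hm hw n n (hKs hz))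
      ((pseudoHypDist_iterate_aut_le hd hm hw n (hKs hz)).trans (hr z hz))
    rw [← le_div_iff₀ hr1'] at h1
    have h2 := (le_abs_self _).trans (Complex.abs_im_le_norm (φ^[n] (halfPlaneAut (w n) z) - w 0))
    rw [Complex.sub_im] at h2
    linarith
  rw [Metric.uniformCauchySeqOn_iff]
  intro ε hε
  obtain ⟨M, hM⟩ := exists_forall_norm_normalized_sub_lt hd hm hw hl hb hy hx hK hKs
    -- The first bound gives hyperbolic distance at most `1 / 2`, so `D / 2 ≤ 2 B ‖u - z‖ / c`; the
    -- second then gives `D < ε / 2`.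
    (ε := min (c / 2) (c * (ε / 2) / (4 * B))) (by positivity)
  have key : ∀ k, ∀ z ∈ K, dist (φ^[M + k] (halfPlaneAut (w (M + k)) z))
      (φ^[M] (halfPlaneAut (w M) z)) < ε / 2 := by
    intro k z hz
    have h1 := hM M le_rfl k z hz
    rw [lt_min_iff] at h1
    set u := halfPlaneAutInv (w M) (φ^[k] (halfPlaneAut (w (M + k)) z)) with hu
    have hu0 : u ∈ upperHalfPlaneSet :=
      mapsTo_halfPlaneAutInv (hw.mem M) (mapsTo_iterate_aut hm hw k (M + k) (hKs hz))
    have e : φ^[M + k] (halfPlaneAut (w (M + k)) z) = φ^[M] (halfPlaneAut (w M) u) := by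
      rw [hu, halfPlaneAut_inv (hw.mem M), Function.iterate_add_apply]
    rw [e, dist_eq_norm]
    have h2 := pseudoHypDist_map_le (differentiableOn_iterate_aut hd hm hw M M)
      (mapsTo_iterate_aut hm hw M M) (hKs hz) hu0
    have h3 : pseudoHypDist z u ≤ ‖u - z‖ / c := by
      rw [pseudoHypDist_comm, norm_sub_rev]
      exact pseudoHypDist_le_div hc0 hu0 (hc z hz)
    have h4 := norm_sub_mul_le_im (mapsTo_iterate_aut hm hw M M (hKs hz))
      (mapsTo_iterate_aut hm hw M M hu0) (h2.trans h3)
    have h5 := hBound M z hz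
    set D := ‖φ^[M] (halfPlaneAut (w M) u) - φ^[M] (halfPlaneAut (w M) z)‖
    have hD : 0 ≤ D := norm_nonneg _
    have h6 : ‖u - z‖ / c ≤ 1 / 2 := by
      rw [div_le_iff₀ hc0]; linarith [h1.1]
    have h7 : ‖u - z‖ / c < ε / 2 / (4 * B) := by
      rw [div_lt_iff₀ hc0]
      calc _ < _ := h1.2
        _ = _ := by ring
    have h8 : 0 ≤ ‖u - z‖ / c := by positivity
    have h9 : D / 2 ≤ 2 * (‖u - z‖ / c) * B := by
      calc D / 2 ≤ D * (1 - ‖u - z‖ / c) := by nlinarith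
        _ ≤ _ := h4
        _ ≤ _ := by gcongr
    rw [lt_div_iff₀ (by positivity)] at h7
    linarith
  refine ⟨M, fun m hmM n hnM z hz => ?_⟩
  obtain ⟨i, rfl⟩ := Nat.exists_eq_add_of_le hmM
  obtain ⟨j, rfl⟩ := Nat.exists_eq_add_of_le hnM
  have := dist_triangle_right (φ^[M + i] (halfPlaneAut (w (M + i)) z))
    (φ^[M + j] (halfPlaneAut (w (M + j)) z)) (φ^[M] (halfPlaneAut (w M) z))
  linarith [key i z hz, key j z hz]

theorem exists_tendstoUniformlyOn_iterate_aut (hd : DifferentiableOn ℂ φ upperHalfPlaneSet)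
    (hm : Set.MapsTo φ upperHalfPlaneSet upperHalfPlaneSet) (hw : IsBISBS φ w)
    (hl : 0 < l) (hb : 0 < b) (hy : Tendsto (fun n => (w n).im) atTop (𝓝 l))
    (hx : Tendsto (fun n => (w (n + 1)).re - (w n).re) atTop (𝓝 (l * b))) :
    ∃ ψ : ℂ → ℂ, ∀ K : Set ℂ, K ⊆ upperHalfPlaneSet → IsCompact K →
      TendstoUniformlyOn (fun (n : ℕ) (z : ℂ) => φ^[n] (halfPlaneAut (w n) z)) ψ atTop K := by
  refine ⟨fun z => limUnder atTop fun n => φ^[n] (halfPlaneAut (w n) z), fun K hKs hK => ?_⟩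
  have h := uniformCauchySeqOn_iterate_aut hd hm hw hl hb hy hx hK hKs
  exact h.tendstoUniformlyOn_of_tendsto fun z hz => (h.cauchySeq hz).tendsto_limUnder

variable {ψ : ℂ → ℂ}

/-- The iterates stay within a fixed hyperbolic distance of `w 0`, so their heights have a positive
lower bound that survives the limit. -/
theorem mapsTo_of_tendstoUniformlyOn (hd : DifferentiableOn ℂ φ upperHalfPlaneSet)
    (hm : Set.MapsTo φ upperHalfPlaneSet upperHalfPlaneSet) (hw : IsBISBS φ w)
    (hψ : TendstoLocallyUniformlyOn (fun (n : ℕ) (z : ℂ) => φ^[n] (halfPlaneAut (w n) z)) ψ atTop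
      upperHalfPlaneSet) : Set.MapsTo ψ upperHalfPlaneSet upperHalfPlaneSet := by
  intro z hz
  set r := pseudoHypDist Complex.I z
  have hr1 : r < 1 := pseudoHypDist_lt_one (by simp) hz
  have hr0 : 0 ≤ r := pseudoHypDist_nonneg _ _
  have hw0 : 0 < (w 0).im := hw.mem 0
  have h1 : ∀ n, (w 0).im * (1 - r) ≤ (1 + r) * (φ^[n] (halfPlaneAut (w n) z)).im := fun n =>
    im_mul_le_im hw0 (mapsTo_iterate_aut hm hw n n hz) hr1
      (pseudoHypDist_iterate_aut_le hd hm hw n hz)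
  have h2 := ge_of_tendsto'
    (((Complex.continuous_im.tendsto _).comp (hψ.tendsto_at hz)).const_mul (1 + r)) h1
  have h3 : 0 < (w 0).im * (1 - r) := mul_pos hw0 (by linarith)
  exact pos_of_mul_pos_right (h3.trans_le h2) (by linarith)

theorem conj_of_tendstoUniformlyOn (hd : DifferentiableOn ℂ φ upperHalfPlaneSet)
    (hw : IsBISBS φ w)
    (hl : 0 < l) (hy : Tendsto (fun n => (w n).im) atTop (𝓝 l))
    (hx : Tendsto (fun n => (w (n + 1)).re - (w n).re) atTop (𝓝 (l * b)))
    (hψ : TendstoLocallyUniformlyOn (fun (n : ℕ) (z : ℂ) => φ^[n] (halfPlaneAut (w n) z)) ψ atTop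
      upperHalfPlaneSet)
    (hψm : Set.MapsTo ψ upperHalfPlaneSet upperHalfPlaneSet)
    (hψd : DifferentiableOn ℂ ψ upperHalfPlaneSet) {z : ℂ} (hz : z ∈ upperHalfPlaneSet) :
    ψ (z - b) = φ (ψ z) := by
  have hopen : IsOpen upperHalfPlaneSet := isOpen_upperHalfPlaneSet
  have hzb : z - b ∈ upperHalfPlaneSet := by rw [mem_uhp] at hz ⊢; simpa using hz
  have h1 : Tendsto (fun n => φ (φ^[n] (halfPlaneAut (w n) z))) atTop (𝓝 (φ (ψ z))) :=
    ((hd.continuousOn.continuousAt (hopen.mem_nhds (hψm hz))).tendsto).comp (hψ.tendsto_at hz)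
  have hψ' : TendstoLocallyUniformlyOn
      (fun (n : ℕ) (z : ℂ) => φ^[n + 1] (halfPlaneAut (w (n + 1)) z)) ψ atTop
      upperHalfPlaneSet := fun u hu x hx => by
    obtain ⟨t, ht, h⟩ := hψ u hu x hx
    exact ⟨t, ht, (tendsto_add_atTop_nat 1).eventually h⟩
  have h2 := hψ'.tendsto_comp (hψd.continuousOn _ hzb) hzb
    (g := fun n => halfPlaneAutInv (w (n + 1)) (halfPlaneAut (w n) z))
    (tendsto_nhdsWithin_iff.2 ⟨tendsto_autInv_aut_succ hl hy hx z, Eventually.of_forall fun n =>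
      mapsTo_halfPlaneAutInv (hw.mem _) (mapsTo_halfPlaneAut (hw.mem _) hz)⟩)
  refine tendsto_nhds_unique (h2.congr fun n => ?_) h1
  rw [halfPlaneAut_inv (hw.mem _), Function.iterate_succ_apply']

/-- The conjugation is asymptotic to the translates of the dilation by the limit height. -/
theorem tendstoLocallyUniformlyOn_normalized (hd : DifferentiableOn ℂ φ upperHalfPlaneSet)
    (hm : Set.MapsTo φ upperHalfPlaneSet upperHalfPlaneSet) (hw : IsBISBS φ w)
    (hl : 0 < l) (hb : 0 < b) (hy : Tendsto (fun n => (w n).im) atTop (𝓝 l))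
    (hx : Tendsto (fun n => (w (n + 1)).re - (w n).re) atTop (𝓝 (l * b)))
    (hψ : TendstoLocallyUniformlyOn (fun (n : ℕ) (z : ℂ) => φ^[n] (halfPlaneAut (w n) z)) ψ atTop
      upperHalfPlaneSet)
    (hψd : DifferentiableOn ℂ ψ upperHalfPlaneSet) :
    TendstoLocallyUniformlyOn (fun (m : ℕ) (z : ℂ) => (ψ (z + m * b) - (w m).re) / l) id atTop
      upperHalfPlaneSet := by
  rw [tendstoLocallyUniformlyOn_iff_forall_isCompact isOpen_upperHalfPlaneSet]
  intro K hKs hK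
  rw [Metric.tendstoUniformlyOn_iff]
  intro ε hε
  obtain ⟨C, hC⟩ := hK.isBounded.exists_norm_le
  have hC' : ∀ z ∈ K, ‖z‖ ≤ |C| := fun z hz => (hC z hz).trans (le_abs_self C)
  obtain ⟨M, hM⟩ := exists_forall_norm_normalized_sub_lt hd hm hw hl hb hy hx hK hKs
    (ε := ε / 4) (by positivity)
  have hy1 : ∀ᶠ n in atTop, (w n).im < 2 * l := hy.eventually_lt_const (by linarith)
  have hy2 : ∀ᶠ n in atTop, |(w n).im - l| * |C| < l * (ε / 2) := by
    have : Tendsto (fun n => |(w n).im - l| * |C|) atTop (𝓝 0) := by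
      have := (hy.sub_const l).abs.mul_const |C|
      rwa [sub_self, abs_zero, zero_mul] at this
    exact this.eventually_lt_const (by positivity)
  filter_upwards [hy1, hy2, eventually_ge_atTop M] with m h1 h2 hmM z hz
  have hl' : (l : ℂ) ≠ 0 := by exact_mod_cast hl.ne'
  have hzb : z + m * b ∈ upperHalfPlaneSet := by
    have := hKs hz
    rw [mem_uhp] at this ⊢
    simpa using this
  -- Here `φ_k ∘ τ_{m+k} = (φ_k ∘ τ_k) ∘ (τ_k⁻¹ ∘ τ_{m+k})`, whose inner factor tends to translation
  -- by `m b`.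
  have h3 := hψ.tendsto_comp (hψd.continuousOn _ hzb) hzb
    (g := fun k => halfPlaneAutInv (w k) (halfPlaneAut (w (m + k)) z))
    (tendsto_nhdsWithin_iff.2 ⟨tendsto_autInv_aut hl hy hx m z, Eventually.of_forall fun n =>
      mapsTo_halfPlaneAutInv (hw.mem _) (mapsTo_halfPlaneAut (hw.mem _) (hKs hz))⟩)
  have h4 : ‖ψ (z + m * b) - halfPlaneAut (w m) z‖ ≤ (w m).im * (ε / 4) := by
    refine le_of_tendsto' (h3.sub_const _).norm fun k => ?_
    rw [halfPlaneAut_inv (hw.mem k)]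
    have h5 := hM m hmM k z hz
    set u := φ^[k] (halfPlaneAut (w (m + k)) z)
    have e : u - halfPlaneAut (w m) z = (w m).im * (halfPlaneAutInv (w m) u - z) := by
      conv_lhs => rw [← halfPlaneAut_inv (hw.mem m) u]
      simp only [halfPlaneAut]
      ring
    rw [e, norm_mul, Complex.norm_real, Real.norm_of_nonneg (hw.mem m).le]
    exact mul_le_mul_of_nonneg_left h5.le (hw.mem m).le
  rw [dist_comm, dist_eq_norm, id]
  have e : (ψ (z + m * b) - (w m).re) / l - z
      = ((ψ (z + m * b) - halfPlaneAut (w m) z) + (((w m).im - l : ℝ) : ℂ) * z) / l := by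
    rw [halfPlaneAut]
    push_cast
    field_simp
    ring
  rw [e, norm_div, Complex.norm_real, Real.norm_of_nonneg hl.le, div_lt_iff₀ hl]
  refine (norm_add_le _ _).trans_lt ?_
  rw [norm_mul, Complex.norm_real, Real.norm_eq_abs]
  have h6 : |(w m).im - l| * ‖z‖ ≤ |(w m).im - l| * |C| := by
    gcongr
    exact hC' z hz
  nlinarith

end Sequence

/-! ### Convex regions with an inner-lateral tangent -/

theorem isSimplyConnected_of_convex {s : Set ℂ} (hs : Convex ℝ s) (hne : s.Nonempty) :
    IsSimplyConnected s := by
  have := hs.contractibleSpace hne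
  exact SimplyConnectedSpace.ofContractible s

theorem HasInnerLateralTangent.of_convex {Ω : Set ℂ} (hc : Convex ℝ Ω) (ho : IsOpen Ω)
    (hs : Ω ⊆ upperHalfPlaneSet)
    (h : ∀ ε : ℝ, 0 < ε → ε < 1 → ∃ R : ℝ, 0 < R ∧ halfStrip R ε ⊆ Ω) :
    HasInnerLateralTangent Ω := by
  refine ⟨ho, isSimplyConnected_of_convex hc ?_, hs, h⟩
  obtain ⟨R, -, hR⟩ := h (1 / 2) (by norm_num) (by norm_num)
  exact ⟨⟨R, 1⟩, hR ⟨le_rfl, by norm_num, by norm_num⟩⟩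

/-- The part of the first quadrant cut out by the curves `x = R k * (y + 1 / y - k)`. -/
def lateralRegion (R : ℕ → ℝ) : Set ℂ :=
  {z | 0 < z.im ∧ 0 < z.re ∧ ∀ k : ℕ, R k * (z.im + z.im⁻¹ - k) < z.re}

/-- Since `y + 1 / y` is convex and `R k ≥ 0`, each constraint cuts out the convex side of its
curve. -/
theorem convex_lateralRegion {R : ℕ → ℝ} (hR : ∀ k, 0 ≤ R k) : Convex ℝ (lateralRegion R) := by
  intro z hz z' hz' a b ha hb hab
  have hinv : (a * z.im + b * z'.im)⁻¹ ≤ a * z.im⁻¹ + b * z'.im⁻¹ := by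
    have := (convexOn_zpow (𝕜 := ℝ) (-1)).2 hz.1 hz'.1 ha hb hab
    simpa using this
  have key : ∀ u u' v v' : ℝ, u < v → u' < v' → a * u + b * u' < a * v + b * v' := by
    intro u u' v v' h h'
    rcases ha.eq_or_lt with rfl | ha'
    · rw [zero_add] at hab
      subst hab
      linarith
    · nlinarith [mul_lt_mul_of_pos_left h ha', mul_le_mul_of_nonneg_left h'.le hb]
  refine ⟨?_, ?_, fun k => ?_⟩
  · simpa using key _ _ _ _ hz.1 hz'.1
  · simpa using key _ _ _ _ hz.2.1 hz'.2.1
  · have h1 := key _ _ _ _ (hz.2.2 k) (hz'.2.2 k)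
    simp only [Complex.add_im, Complex.add_re, Complex.real_smul, Complex.re_ofReal_mul,
      Complex.im_ofReal_mul]
    refine lt_of_le_of_lt ?_ h1
    have h2 := mul_le_mul_of_nonneg_left hinv (hR k)
    have h3 : (k : ℝ) = a * k + b * k := by rw [← add_mul, hab, one_mul]
    linear_combination h2 - R k * h3

/-- The constraints are locally finite: once `k` exceeds `y + 1 / y`, the `k`-th one follows from `0
< x`. -/
theorem isOpen_lateralRegion {R : ℕ → ℝ} (hR : ∀ k, 0 ≤ R k) : IsOpen (lateralRegion R) := by
  rw [isOpen_iff_mem_nhds]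
  intro z hz
  have hcont : ContinuousAt (fun z : ℂ => z.im + z.im⁻¹) z :=
    Complex.continuous_im.continuousAt.add
      (Complex.continuous_im.continuousAt.inv₀ hz.1.ne')
  obtain ⟨N, hN⟩ := exists_nat_gt (z.im + z.im⁻¹)
  have h1 : ∀ᶠ u in 𝓝 z, ∀ k ∈ Finset.range N, R k * (u.im + u.im⁻¹ - k) < u.re := by
    rw [Filter.eventually_all_finset]
    intro k _
    exact ((hcont.sub continuousAt_const).const_mul (R k)).eventually_lt
      Complex.continuous_re.continuousAt (hz.2.2 k)
  filter_upwards [h1, hcont.eventually_lt_const hN,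
    Complex.continuous_im.continuousAt.eventually_const_lt hz.1,
    Complex.continuous_re.continuousAt.eventually_const_lt hz.2.1] with u hu1 hu2 hu3 hu4
  refine ⟨hu3, hu4, fun k => ?_⟩
  by_cases hk : k < N
  · exact hu1 k (Finset.mem_range.2 hk)
  · have : (N : ℝ) ≤ k := by exact_mod_cast not_lt.1 hk
    exact (mul_nonpos_of_nonneg_of_nonpos (hR k) (by linarith)).trans_lt hu4

theorem exists_halfStrip_subset_lateralRegion {R : ℕ → ℝ} (hR : ∀ k, 0 ≤ R k) {ε : ℝ}
    (hε : 0 < ε) : ∃ r : ℝ, 0 < r ∧ halfStrip r ε ⊆ lateralRegion R := by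
  obtain ⟨N, hN⟩ := exists_nat_gt (1 / ε + 1 / ε)
  have hN0 : (0 : ℝ) ≤ N := Nat.cast_nonneg N
  have hsum : 0 ≤ ∑ k ∈ Finset.range N, R k * N :=
    Finset.sum_nonneg fun k _ => mul_nonneg (hR k) hN0
  refine ⟨1 + ∑ k ∈ Finset.range N, R k * N, by linarith, fun z ⟨h1, h2, h3⟩ => ?_⟩
  have h4 : z.im⁻¹ ≤ 1 / ε := by rw [one_div]; exact inv_anti₀ hε h2
  have hre : 0 < z.re := by linarith
  refine ⟨by linarith, hre, fun k => ?_⟩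
  by_cases hk : k < N
  · have h5 : R k * N ≤ ∑ k ∈ Finset.range N, R k * N :=
      Finset.single_le_sum (f := fun k => R k * (N : ℝ)) (fun k _ => mul_nonneg (hR k) hN0)
        (Finset.mem_range.2 hk)
    have h6 : R k * (z.im + z.im⁻¹ - k) ≤ R k * N := by
      refine mul_le_mul_of_nonneg_left ?_ (hR k)
      have : (0 : ℝ) ≤ k := Nat.cast_nonneg k
      linarith
    linarith
  · have : (N : ℝ) ≤ k := by exact_mod_cast not_lt.1 hk
    exact (mul_nonpos_of_nonneg_of_nonpos (hR k) (by linarith)).trans_lt hre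

/-- A property holding far out in every half-strip holds on a convex region with an inner-lateral
tangent. -/
theorem exists_convex_hasInnerLateralTangent {P : ℂ → Prop}
    (h : ∀ ε : ℝ, 0 < ε → ε < 1 → ∃ R : ℝ, ∀ z ∈ halfStrip R ε, P z) :
    ∃ Ω : Set ℂ, Convex ℝ Ω ∧ HasInnerLateralTangent Ω ∧ ∀ z ∈ Ω, P z := by
  have h' : ∀ k : ℕ, ∃ R : ℝ, 0 ≤ R ∧ ∀ z ∈ halfStrip R (1 / (k + 2)), P z := by
    intro k
    obtain ⟨R, hR⟩ := h (1 / (k + 2)) (by positivity) (by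
      rw [div_lt_one (by positivity)]
      have : (0 : ℝ) ≤ k := Nat.cast_nonneg k
      linarith)
    exact ⟨max R 0, le_max_right _ _, fun z hz => hR z ⟨(le_max_left _ _).trans hz.1, hz.2⟩⟩
  choose R hR0 hR using h'
  refine ⟨lateralRegion R, convex_lateralRegion hR0,
    .of_convex (convex_lateralRegion hR0) (isOpen_lateralRegion hR0) (fun z hz => hz.1)
      fun ε hε _ => exists_halfStrip_subset_lateralRegion hR0 hε, fun z hz => ?_⟩
  obtain ⟨h1, -, h3⟩ := hz
  have h4 : 0 < z.im⁻¹ := inv_pos.2 h1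
  have h5 : 1 ≤ z.im + z.im⁻¹ := by
    have := mul_inv_cancel₀ h1.ne'
    nlinarith [sq_nonneg (z.im - z.im⁻¹)]
  -- With `k + 1 ≤ y + 1 / y < k + 2`, the `k`-th constraint gives `x ≥ R k`, and both `y` and `1 /
  -- y` are below `k + 2`, the width used for `R k`.
  obtain ⟨k, hk⟩ : ∃ k, ⌊z.im + z.im⁻¹⌋₊ = k + 1 :=
    Nat.exists_eq_succ_of_ne_zero (Nat.floor_pos.2 h5).ne'
  have h6 := (Nat.floor_eq_iff (by linarith)).1 hk
  push_cast at h6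
  refine hR k z ⟨?_, ?_, ?_⟩
  · have := h3 k
    nlinarith [hR0 k]
  · rw [one_div]
    exact inv_le_of_inv_le₀ h1 (by linarith)
  · rw [one_div_one_div]
    linarith

/-! ### Injectivity, topology of images, and covering -/

/-- By convexity `f - id` is `1 / 2`-Lipschitz, hence cannot cancel the identity. -/
theorem injOn_of_norm_deriv_sub_one_lt {f : ℂ → ℂ} {Ω : Set ℂ} (hc : Convex ℝ Ω)
    (hf : ∀ z ∈ Ω, DifferentiableAt ℂ f z) (h : ∀ z ∈ Ω, ‖deriv f z - 1‖ < 1 / 2) :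
    Set.InjOn f Ω := by
  intro z hz u hu hzu
  have := hc.norm_image_sub_le_of_norm_deriv_le (f := fun z => f z - z) (C := 1 / 2)
    (fun x hx => (hf x hx).sub differentiableAt_id) (fun x hx => by
      have e : deriv (fun z => f z - z) x = deriv f x - 1 := by
        rw [deriv_fun_sub (hf x hx) differentiableAt_fun_id, deriv_id'']
      rw [e]
      exact (h x hx).le) hz hu
  simp only [hzu] at this
  rw [show f u - u - (f u - z) = -(u - z) by ring, norm_neg] at this
  have h0 : ‖u - z‖ = 0 := le_antisymm (by linarith) (norm_nonneg _)
  exact (sub_eq_zero.1 (norm_eq_zero.1 h0)).symm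

theorem isOpenEmbedding_restrict {f : ℂ → ℂ} {Ω : Set ℂ} (ho : IsOpen Ω)
    (hf : DifferentiableOn ℂ f Ω) (hinj : Set.InjOn f Ω) (h : ∀ z ∈ Ω, deriv f z ≠ 0) :
    IsOpenEmbedding (Ω.domRestrict f) := by
  refine .of_continuous_injective_isOpenMap (continuousOn_iff_continuous_domRestrict.1 hf.continuousOn)
    hinj.injective ?_
  rw [isOpenMap_iff_nhds_le]
  rintro ⟨z, hz⟩
  have hs : HasStrictDerivAt f (deriv f z) z :=
    ((hf.analyticAt (ho.mem_nhds hz)).contDiffAt (n := 1)).hasStrictDerivAt one_ne_zero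
  have := hs.map_nhds_eq (h z hz)
  rw [Set.domRestrict_apply, ← this, ← ho.isOpenEmbedding_subtypeVal.map_nhds_eq ⟨z, hz⟩,
    Filter.map_map]
  rfl

theorem isOpen_image_of_injOn {f : ℂ → ℂ} {Ω : Set ℂ} (ho : IsOpen Ω)
    (hf : DifferentiableOn ℂ f Ω) (hinj : Set.InjOn f Ω) (h : ∀ z ∈ Ω, deriv f z ≠ 0) :
    IsOpen (f '' Ω) := by
  rw [← Set.range_domRestrict]
  exact (isOpenEmbedding_restrict ho hf hinj h).isOpen_range

theorem isSimplyConnected_image_of_injOn {f : ℂ → ℂ} {Ω : Set ℂ} (ho : IsOpen Ω)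
    (hsc : IsSimplyConnected Ω)
    (hf : DifferentiableOn ℂ f Ω) (hinj : Set.InjOn f Ω) (h : ∀ z ∈ Ω, deriv f z ≠ 0) :
    IsSimplyConnected (f '' Ω) := by
  have e := (isOpenEmbedding_restrict ho hf hinj h).isEmbedding.toHomeomorph
  rw [Set.range_domRestrict] at e
  exact e.toHomotopyEquiv.simplyConnectedSpace_iff.1 hsc

/-- A holomorphic map that is injective and close to the identity on a disc covers the centre. -/
theorem mem_image_closedBall_of_norm_sub_lt {f : ℂ → ℂ} {c : ℂ} {r : ℝ} (hr : 0 < r)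
    (hf : DiffContOnCl ℂ f (Metric.ball c r)) (hinj : Set.InjOn f (Metric.ball c r))
    (h : ∀ z ∈ Metric.closedBall c r, ‖f z - z‖ < r / 8) : c ∈ f '' Metric.closedBall c r := by
  have hc := h c (Metric.mem_closedBall_self hr.le)
  -- On the circle `‖f z - f c‖ ≥ r - 2 r / 8`, so the image contains the disc of radius `3 r / 8`
  -- about `f c`, which contains `c`.
  refine hf.ball_subset_image_closedBall (ε := 3 / 4 * r) hr (fun z hz => ?_) ?_ ?_
  · have h1 := h z (Metric.sphere_subset_closedBall hz)
    rw [mem_sphere_iff_norm] at hz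
    have h2 := norm_sub_le (f z - f c) ((f z - z) - (f c - c))
    rw [show f z - f c - (f z - z - (f c - c)) = z - c by ring, hz] at h2
    have h3 := norm_sub_le (f z - z) (f c - c)
    linarith
  · have : ∀ᶠ z in 𝓝[≠] c, f z ≠ f c := by
      filter_upwards [self_mem_nhdsWithin, mem_nhdsWithin_of_mem_nhds (Metric.ball_mem_nhds c hr)]
        with z hz hzb hfz
      exact hz (hinj hzb (Metric.mem_ball_self hr) hfz)
    exact this.frequently.filter_mono nhdsWithin_le_nhds
  · rw [mem_ball_iff_norm, norm_sub_rev]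
    linarith

/-! ### Half-strips under the asymptotic form of the conjugation -/

section Asymptotic

variable {ψ : ℂ → ℂ} {x : ℕ → ℝ} {l b : ℝ}

theorem isCompact_rectangle (a b c d : ℝ) :
    IsCompact {z : ℂ | z.re ∈ Set.Icc a b ∧ z.im ∈ Set.Icc c d} :=
  isCompact_Icc.reProdIm isCompact_Icc

/-- Locally uniform convergence passes to derivatives. Translating by a multiple of `b` brings each
point of the half-strip into one compact rectangle of width `b`. -/
theorem exists_halfStrip_norm_deriv_sub_one_lt (hb : 0 < b)
    (hd : DifferentiableOn ℂ ψ upperHalfPlaneSet)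
    (hN : TendstoLocallyUniformlyOn (fun (m : ℕ) (z : ℂ) => (ψ (z + m * b) - x m) / l) id atTop
      upperHalfPlaneSet) {ε : ℝ} (hε : 0 < ε) :
    ∃ R : ℝ, ∀ z ∈ halfStrip R ε, ‖deriv (fun z => ψ z / l) z - 1‖ < 1 / 2 := by
  have hmem : ∀ (m : ℕ) (z : ℂ), z ∈ upperHalfPlaneSet → z + m * b ∈ upperHalfPlaneSet := by
    intro m z hz
    rw [mem_uhp] at hz ⊢
    simpa using hz
  have hdiff : ∀ m : ℕ, DifferentiableOn ℂ (fun z => (ψ (z + m * b) - x m) / l)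
      upperHalfPlaneSet := fun m =>
    ((hd.comp (differentiable_id.add_const _).differentiableOn (hmem m)).sub_const _).div_const _
  have hder := (tendstoLocallyUniformlyOn_iff_forall_isCompact isOpen_upperHalfPlaneSet).1
    (hN.deriv (Eventually.of_forall hdiff) isOpen_upperHalfPlaneSet) _ (fun z hz =>
      show 0 < z.im from hε.trans_le hz.2.1) (isCompact_rectangle 0 b ε (1 / ε))
  obtain ⟨M, hM⟩ := eventually_atTop.1 (Metric.tendstoUniformlyOn_iff.1 hder (1 / 2) (by norm_num))
  refine ⟨M * b, fun z ⟨h1, h2, h3⟩ => ?_⟩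
  have hre : 0 ≤ z.re / b := div_nonneg (le_trans (by positivity) h1) hb.le
  set m := ⌊z.re / b⌋₊ with hm
  have hmM : M ≤ m := Nat.le_floor ((le_div_iff₀ hb).2 h1)
  have h4 := Nat.floor_le hre
  have h5 := Nat.lt_floor_add_one (z.re / b)
  rw [← hm, le_div_iff₀ hb] at h4
  rw [← hm, div_lt_iff₀ hb] at h5
  have h6 := hM m hmM (z - m * b) (by
    refine ⟨⟨?_, ?_⟩, ?_, ?_⟩ <;> simp <;> first | linarith | simpa using h3)
  rw [dist_comm, dist_eq_norm, Function.comp_apply, deriv_id] at h6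
  have e : deriv (fun z => (ψ (z + m * b) - x m) / l) (z - m * b) = deriv (fun z => ψ z / l) z := by
    have : (fun z => (ψ (z + m * b) - x m) / (l : ℂ))
        = fun z => (fun u => ψ u / (l : ℂ) - x m / l) (z + m * b) := by
      funext z
      ring
    rw [this, deriv_comp_add_const (fun u => ψ u / (l : ℂ) - x m / l), sub_add_cancel,
      deriv_sub_const]
  rwa [e] at h6

/-- The image of a region with an inner-lateral tangent contains half-strips of all widths. -/
theorem exists_halfStrip_subset_image (hl : 0 < l) (hb : 0 < b)
    (hd : DifferentiableOn ℂ ψ upperHalfPlaneSet)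
    (hxt : Tendsto x atTop atTop) (hx : Tendsto (fun n => x (n + 1) - x n) atTop (𝓝 (l * b)))
    (hN : TendstoLocallyUniformlyOn (fun (m : ℕ) (z : ℂ) => (ψ (z + m * b) - x m) / l) id atTop
      upperHalfPlaneSet) {Ω : Set ℂ} (hΩ : HasInnerLateralTangent Ω) (hinj : Set.InjOn ψ Ω)
    {ε : ℝ} (hε : 0 < ε) : ∃ R : ℝ, 0 < R ∧ halfStrip R ε ⊆ ψ '' Ω := by
  have hl' : (l : ℂ) ≠ 0 := by exact_mod_cast hl.ne'
  -- After division by `l`, the heights `[ε, 1 / ε]` become `[2 r, T - r]`, leaving room for discs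
  -- of radius `r` at heights in `[r, T]`.
  set r := ε / (2 * l) with hr
  have hr0 : 0 < r := by positivity
  set T := 1 / (ε * l) + r with hT
  have hT0 : 0 < T := by positivity
  obtain ⟨M₁, hM₁⟩ := eventually_atTop.1 (Metric.tendstoUniformlyOn_iff.1
    ((tendstoLocallyUniformlyOn_iff_forall_isCompact isOpen_upperHalfPlaneSet).1 hN _
      (fun z hz => show 0 < z.im from hr0.trans_le hz.2.1)
      (isCompact_rectangle (-r) (2 * b + r) r T)) (r / 8) (by positivity))
  obtain ⟨R', -, hR'⟩ := hΩ.strips (min (1 / 2) (min r (1 / T))) (by positivity)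
    ((min_le_left _ _).trans_lt (by norm_num))
  obtain ⟨M₂, hM₂⟩ := exists_nat_gt ((R' + r) / b)
  rw [div_lt_iff₀ hb] at hM₂
  have hlb : 0 < l * b := mul_pos hl hb
  obtain ⟨M₃, hM₃⟩ := eventually_atTop.1
    (hx.eventually_lt_const (show l * b < 2 * (l * b) by linarith))
  set M := max M₁ (max M₂ M₃) with hM
  refine ⟨max 1 (x M), by positivity, fun ζ ⟨h1, h2, h3⟩ => ?_⟩
  -- Without such an `m`, induction from `M` would bound `x` by `Re ζ`. The step bound `2 l b` then
  -- places `ω` in the compact rectangle.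
  obtain ⟨m, hmM, hm1, hm2⟩ : ∃ m ≥ M, x m ≤ ζ.re ∧ ζ.re < x (m + 1) := by
    by_contra! hcon
    have hle : ∀ k, x (M + k) ≤ ζ.re := by
      intro k
      induction k with
      | zero => exact (le_max_right _ _).trans h1
      | succ k ih => exact hcon (M + k) (by omega) ih
    obtain ⟨K, hK⟩ := eventually_atTop.1 (hxt.eventually_gt_atTop ζ.re)
    exact absurd (hK (M + K) (by omega)) (not_lt.2 (hle K))
  have hmM₁ : M₁ ≤ m := (le_max_left _ _).trans hmM
  have hmM₂ : M₂ ≤ m := (le_max_left _ _).trans ((le_max_right _ _).trans hmM)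
  have hmM₃ : M₃ ≤ m := (le_max_right _ _).trans ((le_max_right _ _).trans hmM)
  have hstep := hM₃ m hmM₃
  set ω : ℂ := (ζ - x m) / l with hω
  have hωre : ω.re = (ζ.re - x m) / l := by rw [hω, Complex.div_ofReal_re]; simp
  have hωim : ω.im = ζ.im / l := by rw [hω, Complex.div_ofReal_im]; simp
  have hre0 : 0 ≤ ω.re := by rw [hωre]; exact div_nonneg (by linarith) hl.le
  have hre1 : ω.re ≤ 2 * b := by rw [hωre, div_le_iff₀ hl]; linarith
  have him0 : 2 * r ≤ ω.im := by
    rw [hωim, hr, le_div_iff₀ hl]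
    calc _ = ε := by field_simp
      _ ≤ _ := h2
  have him1 : ω.im ≤ T - r := by
    rw [hωim, hT, add_sub_cancel_right, div_le_iff₀ hl]
    calc _ ≤ _ := h3
      _ = _ := by field_simp
  have hball : ∀ z ∈ Metric.closedBall ω r,
      z.re ∈ Set.Icc (-r) (2 * b + r) ∧ z.im ∈ Set.Icc r T := by
    intro z hz
    rw [mem_closedBall_iff_norm] at hz
    have a1 := abs_le.1 ((Complex.abs_re_le_norm (z - ω)).trans hz)
    have a2 := abs_le.1 ((Complex.abs_im_le_norm (z - ω)).trans hz)
    rw [Complex.sub_re] at a1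
    rw [Complex.sub_im] at a2
    exact ⟨⟨by linarith, by linarith⟩, by linarith, by linarith⟩
  have hmemΩ : ∀ z ∈ Metric.closedBall ω r, z + m * b ∈ Ω := by
    intro z hz
    obtain ⟨⟨a1, -⟩, a2, a3⟩ := hball z hz
    refine hR' ⟨?_, ?_, ?_⟩
    · have : (M₂ : ℝ) * b ≤ m * b := by gcongr
      simp
      linarith
    · simp only [Complex.add_im, Complex.mul_im, Complex.natCast_re, Complex.ofReal_im,
        Complex.natCast_im, Complex.ofReal_re, mul_zero, zero_mul, add_zero]
      exact ((min_le_right _ _).trans (min_le_left _ _)).trans a2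
    · simp only [Complex.add_im, Complex.mul_im, Complex.natCast_re, Complex.ofReal_im,
        Complex.natCast_im, Complex.ofReal_re, mul_zero, zero_mul, add_zero]
      refine a3.trans ?_
      rw [le_div_iff₀ (by positivity)]
      calc _ ≤ T * (1 / T) := by
            gcongr
            exact (min_le_right _ _).trans (min_le_right _ _)
        _ = 1 := by field_simp
  have hdf : DifferentiableOn ℂ (fun z => (ψ (z + m * b) - x m) / l) (Metric.closedBall ω r) :=
    (((hd.mono hΩ.subset).comp (differentiable_id.add_const _).differentiableOn
      hmemΩ).sub_const _).div_const _
  obtain ⟨z, hz, hzω⟩ := mem_image_closedBall_of_norm_sub_lt hr0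
    (hdf.mono Metric.closure_ball_subset_closedBall).diffContOnCl (fun u hu v hv huv => by
      have e := (div_left_inj' hl').1 huv
      have := hinj (hmemΩ u (Metric.ball_subset_closedBall hu))
        (hmemΩ v (Metric.ball_subset_closedBall hv)) (sub_left_injective e)
      exact add_right_cancel this) (fun z hz => by
      have := hM₁ m hmM₁ z (hball z hz)
      rwa [dist_comm, dist_eq_norm] at this)
  refine ⟨z + m * b, hmemΩ z hz, ?_⟩
  simp only [hω] at hzω
  exact sub_left_injective ((div_left_inj' hl').1 hzω)

end Asymptotic

/-! ### Assembly of the conjugation and the region -/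

theorem corollary3p4 (φ : ℂ → ℂ) (hφ : IsParabolicSelfMap φ)
    (w : ℕ → ℂ) (hw : IsBISBS φ w)
    (hw_infty : Tendsto w atTop (Bornology.cobounded ℂ))
    (hw_type : IsTypeOne w)
    (hw_arg : Tendsto (fun n => (w n).arg) atTop (𝓝 0)) :
    ∃ (ψ : ℂ → ℂ) (b₀ : ℝ), IsConjugation φ w ψ b₀ ∧
      ∃ Ω : Set ℂ, Convex ℝ Ω ∧ HasInnerLateralTangent Ω ∧
        Set.InjOn ψ Ω ∧ HasInnerLateralTangent (ψ '' Ω) := by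
  obtain ⟨l, hl, hy⟩ := hw_type
  have hd := hφ.analytic
  have hm := hφ.mapsTo
  have hxt := tendsto_re_atTop hw_infty hw_arg
  obtain ⟨a, b, ha1, hb, hab, hlim, hx⟩ := exists_step_asymptotics hd hm hw hxt hl hy
  obtain ⟨ψ, hψ⟩ := exists_tendstoUniformlyOn_iterate_aut hd hm hw hl hb hy hx
  have hψ' := (tendstoLocallyUniformlyOn_iff_forall_isCompact isOpen_upperHalfPlaneSet).2 hψ
  have hψd : DifferentiableOn ℂ ψ upperHalfPlaneSet := hψ'.differentiableOn
    (Eventually.of_forall fun n => differentiableOn_iterate_aut hd hm hw n n)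
    isOpen_upperHalfPlaneSet
  have hψm := mapsTo_of_tendstoUniformlyOn hd hm hw hψ'
  have hratio : Tendsto (fun n => ((w (n + 1)).re - (w n).re) / (w n).im) atTop (𝓝 b) := by
    have := hx.div hy hl.ne'
    rwa [mul_div_cancel_left₀ _ hl.ne'] at this
  refine ⟨ψ, b, ⟨hψ, hψd, hψm,
    fun z hz => conj_of_tendstoUniformlyOn hd hw hl hy hx hψ' hψm hψd hz,
    ⟨a, ha1, hlim, hab⟩, hratio⟩, ?_⟩
  have hN := tendstoLocallyUniformlyOn_normalized hd hm hw hl hb hy hx hψ' hψd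
  obtain ⟨Ω, hΩc, hΩ, hder⟩ := exists_convex_hasInnerLateralTangent
    fun ε hε _ => exists_halfStrip_norm_deriv_sub_one_lt hb hψd hN hε
  have hat : ∀ z ∈ Ω, DifferentiableAt ℂ ψ z := fun z hz =>
    hψd.differentiableAt (isOpen_upperHalfPlaneSet.mem_nhds (hΩ.subset hz))
  have hinj : Set.InjOn ψ Ω := fun u hu v hv huv =>
    injOn_of_norm_deriv_sub_one_lt hΩc (fun z hz => (hat z hz).div_const _) hder hu hv
      (by simp only [huv])
  have hne : ∀ z ∈ Ω, deriv ψ z ≠ 0 := by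
    intro z hz h0
    have := hder z hz
    rw [deriv_div_const, h0] at this
    norm_num at this
  have hΩd := hψd.mono hΩ.subset
  exact ⟨Ω, hΩc, hΩ, hinj, isOpen_image_of_injOn hΩ.isOpen hΩd hinj hne,
    isSimplyConnected_image_of_injOn hΩ.isOpen hΩ.simplyConnected hΩd hinj hne,
    (hψm.mono_left hΩ.subset).image_subset,
    fun ε hε _ => exists_halfStrip_subset_image hl hb hψd hxt hx hN hΩ hinj hε⟩
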